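/- Let $d>4$ be even, write $z=(x,y)\in\mathbb R^{d/2}\times\mathbb R^{d/2}$, and let $F(z)=F_0(z)=x\cdot y$ and $A(x,y)=(y,x)$, so that $F(z)=\frac12 Az\cdot z$. For $t\in\mathbb R$ put $F^t=F-t$ and $\Sigma_t=\{z\in\mathbb R^d: F^t(z)=0\}$, and write $e_q(x)=e^{2\pi i x/q}$, $\langle z\rangle=\max\{1,|z|\}$ and $$\|f\|_{n_1,n_2}=\sup_{z\in\mathbb R^d}\max_{|\alpha|\le n_1}|\partial^\alpha f(z)|\,\langle z\rangle^{n_2}.$$ Let $w_0(x)=\exp\left(\frac1{x^2-1}\right)$ for $|x|<1$ and $w_0(x)=0$ for $|x|\ge1$. With $c_0=\int_{\mathbb R} w_0$ and $\omega(x)=\frac4{c_0}w_0(4x-3)$, put, for $x>0$ and $y\in\mathbb R$, $$h(x,y)=\sum_{j\ge1}\frac1{xj}\left(\omega(xj)-\omega\left(\frac{|y|}{xj}\right)\right).$$ For $L>1$ and $m\in\mathbb R$ with $mL^2\in\mathbb Z$, and for a real function $w$ on $\mathbb R^d$, let $$S_q(0)=\sum_{\substack{a\bmod q\\(a,q)=1}}\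 \sum_{b\in(\mathbb Z/q\mathbb Z)^d}e_q\left(aF^{mL^2}(b)\right)\quad(\text{so } S_1(0)=1),\qquad I_q(0)=\int_{\mathbb R^d}w\left(\frac zL\right)h\left(\frac qL,\frac{F^{mL^2}(z)}{L^2}\right)dz,$$ $$J_0=\sum_{q=1}^\infty q^{-d}S_q(0)I_q(0),\qquad \sigma_p=\sum_{l=0}^\infty p^{-dl}S_{p^l}(0),\qquad \sigma_\infty(w;F,m)=\int_{\Sigma_m}w(z)\,|Az|^{-1}\,dz|_{\Sigma_m},$$ where $dz|_{\Sigma_m}$ is the Euclidean hypersurface measure on $\Sigma_m$ (for $m=0$ the origin has measure zero). **Proposition.** For every $0<\gamma_2<1$ and every compact interval $K\subset\mathbb R$ there is a constant $C=C(d,\gamma_2,K)$ such that for all $m\in K$, all $L>1$ with $mL^2\in\mathbb Z$, and all $w\in C^{d/2-2}(\mathbb R^d)$ with $\|w\|_{d/2-2,d-1}<\infty$ and $\|w\|_{0,d+1}<\infty$, the integrals, the series and the product $\prod_p\sigma_p$ over all primes converge absolutely (the product unconditionally), and $$\Big|J_0-L^d\,\sigma_\infty(w;F,m)\prod_p\sigma_p\Big|\le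 C\,L^{\frac d2+2+\gamma_2\left(\frac d2-1\right)}\left(\|w\|_{d/2-2,d-1}+\|w\|_{0,d+1}\right).$$ No vanishing of $w$ near the origin is assumed. -/

import Mathlib

open MeasureTheory

noncomputable section

namespace QuadCircle

/-- `ℝ^d` with `d = 2k`, written as pairs `z = (x, y)` with `x, y ∈ ℝ^k` and with the Euclidean norm:
`x_i = z (Sum.inl i)` and `y_i = z (Sum.inr i)`. -/
abbrev Space (k : ℕ) : Type := EuclideanSpace ℝ (Fin k ⊕ Fin k)

/-- The quadratic form `F₀(x, y) = x · y`. -/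
def F0 {k : ℕ} (z : Space k) : ℝ := ∑ i : Fin k, z (Sum.inl i) * z (Sum.inr i)

/-- `F^t = F₀ - t`. -/
def Ft {k : ℕ} (t : ℝ) (z : Space k) : ℝ := F0 z - t

/-- The symmetric matrix of `F₀ = ½ A₀ z · z`, as a map: `A₀(x, y) = (y, x)`. -/
def A0 {k : ℕ} (z : Space k) : Space k := WithLp.toLp 2 (fun i => z i.swap)

/-- The quadric `Σ_t = {z : F^t(z) = 0}`. -/
def quadric (k : ℕ) (t : ℝ) : Set (Space k) := {z | Ft t z = 0}

/-- The measure `μ^{Σ_t}(dz) = |A₀ z|⁻¹ dz|_{Σ_t}`, as a measure on `ℝ^d` carried by `Σ_t`. The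
Euclidean hypersurface measure `dz|_{Σ_t}` is the `(d-1)`-dimensional Hausdorff measure on `Σ_t`,
normalised so that it agrees with Lebesgue measure on `ℝ^(d-1)`; the origin, which is the only
singular point of `Σ_0`, is a null set for it. -/
def quadricMeasure (k : ℕ) (t : ℝ) : Measure (Space k) :=
  ((Measure.euclideanHausdorffMeasure (2 * k - 1)).restrict (quadric k t)).withDensity
    (fun z => ENNReal.ofReal ‖A0 z‖⁻¹)

/-- The singular integral `σ_∞(w; F₀, m) = ∫_{Σ_m} w dμ^{Σ_m}`. -/
def sigmaInf {k : ℕ} (w : Space k → ℝ) (m : ℝ) : ℝ := ∫ z, w z ∂(quadricMeasure k m)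

/-- `e_q(x) = exp(2πi x / q)`. -/
def expQ (q : ℕ) (x : ℝ) : ℂ := Complex.exp (2 * Real.pi * Complex.I * x / q)

/-- An integer vector with given coordinates, as a point of `ℝ^d`. -/
def intVec {k : ℕ} (b : Fin k ⊕ Fin k → ℤ) : Space k := WithLp.toLp 2 (fun i => (b i : ℝ))

/-- The scalar product of `ℝ^d`, in coordinates. -/
def dot {k : ℕ} (z z' : Space k) : ℝ := ∑ i, z i * z' i

/-- `S_q(c) = ∑*_{a mod q} ∑_{b mod q} e_q(a F^t(b) + c · b)`, where `∑*` runs over the residues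
coprime to `q` (for `q = 1` this is the one residue `0`, so that `S_1 = 1`). Residues mod `q` are
represented by `0, …, q - 1`; for integer `t` the choice of representatives is irrelevant. -/
def expSum (k : ℕ) (t : ℝ) (q : ℕ) (c : Fin k ⊕ Fin k → ℤ) : ℂ :=
  ∑ a ∈ (Finset.range q).filter (fun a => Nat.Coprime a q),
    ∑ b : Fin k ⊕ Fin k → Fin q,
      expQ q ((a : ℝ) * Ft t (intVec (fun i => ((b i : ℕ) : ℤ)))
        + dot (intVec c) (intVec (fun i => ((b i : ℕ) : ℤ))))

/-- `l`-th term of the series for `σ_p`: `p^{-dl} S_{p^l}(0)`. -/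
def sigmaPTerm (k : ℕ) (t : ℝ) (p l : ℕ) : ℂ :=
  (((p : ℂ) ^ (2 * k * l))⁻¹) * expSum k t (p ^ l) 0

/-- The local density `σ_p = ∑_{l ≥ 0} p^{-dl} S_{p^l}(0)`. -/
def sigmaP (k : ℕ) (t : ℝ) (p : ℕ) : ℂ := ∑' l : ℕ, sigmaPTerm k t p l

/-- The bump function `w₀`. -/
def bump (x : ℝ) : ℝ := if |x| < 1 then Real.exp (1 / (x ^ 2 - 1)) else 0

/-- `c₀ = ∫ w₀`. -/
def bumpMass : ℝ := ∫ x : ℝ, bump x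

/-- `ω(x) = (4 / c₀) w₀(4x - 3)`. -/
def omega (x : ℝ) : ℝ := 4 / bumpMass * bump (4 * x - 3)

/-- `h₁(x) = ∑_{j ≥ 1} ω(xj) / (xj)`. -/
def hOne (x : ℝ) : ℝ := ∑' j : ℕ+, 1 / (x * j) * omega (x * j)

/-- `h₂(x, y) = ∑_{j ≥ 1} ω(|y| / (xj)) / (xj)`. -/
def hTwo (x y : ℝ) : ℝ := ∑' j : ℕ+, 1 / (x * j) * omega (|y| / (x * j))

/-- The function `h = h₁ - h₂` of the delta method, for `x > 0`. -/
def hFun (x y : ℝ) : ℝ := hOne x - hTwo x y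

/-- The integrand of `I_q(c)`. -/
def oscIntegrand {k : ℕ} (w : Space k → ℝ) (m L : ℝ) (q : ℕ) (c : Fin k ⊕ Fin k → ℤ)
    (z : Space k) : ℂ :=
  ((w (L⁻¹ • z) * hFun (q / L) (Ft (m * L ^ 2) z / L ^ 2) : ℝ) : ℂ) * expQ q (-dot z (intVec c))

/-- `I_q(c) = ∫ w(z/L) h(q/L, F^{mL²}(z)/L²) e_q(-z · c) dz`. -/
def oscIntegral {k : ℕ} (w : Space k → ℝ) (m L : ℝ) (q : ℕ) (c : Fin k ⊕ Fin k → ℤ) : ℂ :=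
  ∫ z : Space k, oscIntegrand w m L q c z

/-- `q`-th term of `n(c)`: `q^{-d} S_q(c) I_q(c)`, with `t = mL²` in `S_q`. -/
def nTerm {k : ℕ} (w : Space k → ℝ) (m L : ℝ) (c : Fin k ⊕ Fin k → ℤ) (q : ℕ+) : ℂ :=
  (((q : ℕ) : ℂ) ^ (2 * k))⁻¹ * expSum k (m * L ^ 2) q c * oscIntegral w m L q c

/-- `n(c) = ∑_{q ≥ 1} q^{-d} S_q(c) I_q(c)`. -/
def nFreq {k : ℕ} (w : Space k → ℝ) (m L : ℝ) (c : Fin k ⊕ Fin k → ℤ) : ℂ :=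
  ∑' q : ℕ+, nTerm w m L c q

/-- The zero-frequency term `J_0 = n(0)`. -/
def J0 {k : ℕ} (w : Space k → ℝ) (m L : ℝ) : ℂ := nFreq w m L 0

/-- `⟨z⟩ = max {1, |z|}`. -/
def bracket {k : ℕ} (z : Space k) : ℝ := max 1 ‖z‖

/-- `∂_{i_1} ⋯ ∂_{i_n} f(z)`: the partial derivative of order `n` along the coordinates `i`. -/
def partialDeriv {k : ℕ} (f : Space k → ℝ) {n : ℕ} (i : Fin n → Fin k ⊕ Fin k) (z : Space k) : ℝ :=
  iteratedFDeriv ℝ n f z (fun j => EuclideanSpace.single (i j) (1 : ℝ))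

/-- `‖f‖_{n₁,n₂} = sup_z max_{|α| ≤ n₁} |∂^α f(z)| ⟨z⟩^{n₂}`, possibly infinite. -/
def weightedNorm {k : ℕ} (n₁ : ℕ) (n₂ : ℝ) (f : Space k → ℝ) : ENNReal :=
  ⨆ (z : Space k) (n : Fin (n₁ + 1)) (i : Fin (n : ℕ) → Fin k ⊕ Fin k),
    ENNReal.ofReal (|partialDeriv f i z| * bracket z ^ n₂)

end QuadCircle

end

open QuadCircle

noncomputable section

namespace QuadCircle

/-! ### Exponential sums, the singular series and its Euler product. -/

section

/-! Put k = d/2 and N = mL². Because the form is split, S_q(0) = q^k c_q(N) with Ramanujan's sum c_q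
(`expSum_zero_eq`). So q^{-d} S_q(0) is multiplicative in q and at most q^{1-k}, uniformly in N, and
the singular series converges absolutely to the product of the σ_p (`hasProd_sigmaP`).

It remains to compare L^{-d} I_q(0), the integral of w against h(x, F₀ - m) with x = q/L, to σ_∞. Up
to a negligible term independent of t, h(x, t) is x⁻¹ K(t/x) (`hFun_eq`), where K decays faster than
any power and, by Poisson summation, has integral 1 and vanishing higher moments
(`integral_univ_pow_mul_deltaKernel`). Hence x⁻¹ K(·/x) acts as a delta function up to O(x^j) on
functions of one variable with j bounded derivatives.

The singular point of Σ_0 does no harm, because F₀ is affine in each x_i with slope y_i. Cut ℝ^d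
into sectors on which |y_i| is the largest of the |y_l|. On a line in the direction x_i the kernel
reproduces w at the point of Σ_m with an error of order x^j |y_i|^{-1-j} (`exists_line_sub_le`), and
this power of |y_i| = max |y_l| is locally integrable over y in ℝ^k as long as j ≤ k - 2. In the
same sectors the area formula for graphs turns |Az|⁻¹ dz into |y_i|⁻¹ dv (`quadricMeasure_eq_sum`),
so the main terms agree.

The resulting estimate holds for all x > 0 with any exponent s in [0, k - 2]. Taking s = k - 2 - ε,
one sums over all q without a cut at q ~ L: L^{2k} ∑ q^{1-k} (q/L)^{k-2-ε} = L^{k+2+ε} ∑ q^{-1-ε}.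
-/

lemma expQ_add (q : ℕ) (x y : ℝ) : expQ q (x + y) = expQ q x * expQ q y := by
  rw [expQ, expQ, expQ, ← Complex.exp_add]
  congr 1
  push_cast
  ring

lemma expQ_zero (q : ℕ) : expQ q 0 = 1 := by simp [expQ]

lemma expQ_sum {ι : Type*} (s : Finset ι) (q : ℕ) (f : ι → ℝ) :
    expQ q (∑ i ∈ s, f i) = ∏ i ∈ s, expQ q (f i) := by
  classical
  induction s using Finset.induction_on with
  | empty => simp [expQ_zero]
  | insert a s ha ih => rw [Finset.sum_insert ha, Finset.prod_insert ha, expQ_add, ih]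

lemma norm_expQ (q : ℕ) (x : ℝ) : ‖expQ q x‖ = 1 := by
  rw [expQ, Complex.norm_exp]
  have : (2 * Real.pi * Complex.I * x / q : ℂ) = ((2 * Real.pi * x / q : ℝ) : ℂ) * Complex.I := by
    push_cast
    ring
  rw [this, Complex.re_ofReal_mul]
  simp

lemma expQ_mul_nat (q : ℕ) (x : ℝ) (n : ℕ) : expQ q (x * n) = expQ q x ^ n := by
  rw [expQ, expQ, ← Complex.exp_nat_mul]
  congr 1
  push_cast
  ring

lemma expQ_int_eq_one_iff {q : ℕ} (hq : q ≠ 0) (m : ℤ) : expQ q m = 1 ↔ (q : ℤ) ∣ m := by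
  have hq' : (q : ℂ) ≠ 0 := by exact_mod_cast hq
  have h2 : (2 * Real.pi * Complex.I : ℂ) ≠ 0 := Complex.two_pi_I_ne_zero
  rw [expQ, Complex.exp_eq_one_iff]
  constructor
  · rintro ⟨n, hn⟩
    refine ⟨n, ?_⟩
    have : (m : ℂ) = q * n := by
      field_simp at hn
      have h3 : (2 * Real.pi * Complex.I : ℂ) * m = (2 * Real.pi * Complex.I : ℂ) * (q * n) := by
        push_cast at hn
        linear_combination (2 * Real.pi * Complex.I : ℂ) * hn
      exact mul_left_cancel₀ h2 h3
    exact_mod_cast this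
  · rintro ⟨n, rfl⟩
    refine ⟨n, ?_⟩
    push_cast
    field_simp

lemma sum_range_expQ {q : ℕ} (hq : q ≠ 0) (m : ℤ) :
    ∑ y ∈ Finset.range q, expQ q ((m : ℝ) * (y : ℕ)) = if (q : ℤ) ∣ m then (q : ℂ) else 0 := by
  simp_rw [expQ_mul_nat]
  split_ifs with h
  · rw [(expQ_int_eq_one_iff hq m).2 h]
    simp
  · have h1 : expQ q m ≠ 1 := fun h' => h ((expQ_int_eq_one_iff hq m).1 h')
    rw [geom_sum_eq h1, ← expQ_mul_nat]
    have : expQ q ((m : ℝ) * (q : ℕ)) = 1 := by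
      have := (expQ_int_eq_one_iff hq (m * q)).2 (Dvd.intro_left m rfl)
      exact_mod_cast this
    rw [this]
    simp

/-- Orthogonality of characters in y leaves only x = 0, since a is invertible mod q. The value does
not depend on a. -/
lemma sum_sum_expQ {q a : ℕ} (hq : q ≠ 0) (ha : Nat.Coprime a q) :
    ∑ p : Fin q × Fin q, expQ q ((a : ℝ) * (((p.1 : ℕ) : ℝ) * ((p.2 : ℕ) : ℝ))) = q := by
  rw [Fintype.sum_prod_type]
  have h (x : Fin q) : ∑ y : Fin q, expQ q ((a : ℝ) * (((x : ℕ) : ℝ) * ((y : ℕ) : ℝ)))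
      = if (x : ℕ) = 0 then (q : ℂ) else 0 := by
    have h1 := sum_range_expQ hq ((a : ℤ) * ((x : ℕ) : ℤ))
    rw [Finset.sum_range] at h1
    have h2 : ((q : ℤ) ∣ (a : ℤ) * ((x : ℕ) : ℤ)) ↔ (x : ℕ) = 0 := by
      rw [← Nat.cast_mul, Int.natCast_dvd_natCast, ha.symm.dvd_mul_left]
      exact ⟨fun h => Nat.eq_zero_of_dvd_of_lt h x.2, fun h => h ▸ dvd_zero _⟩
    simp only [h2] at h1
    rw [← h1]
    refine Finset.sum_congr rfl fun y _ => ?_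
    congr 1
    push_cast
    ring
  simp_rw [h]
  obtain ⟨q, rfl⟩ := Nat.exists_eq_succ_of_ne_zero hq
  rw [Finset.sum_eq_single (0 : Fin (q + 1))]
  · simp
  · intro b _ hb
    rw [if_neg]
    exact fun h => hb (Fin.ext h)
  · simp

/-- Ramanujan's sum `c_q(N)`. -/
def ramanujanSum (N : ℤ) (q : ℕ) : ℂ :=
  ∑ a ∈ (Finset.range q).filter (fun a => Nat.Coprime a q), expQ q (-((a : ℝ) * N))

/-- The form is a sum of k hyperbolic planes, so the sum over b factors into k double sums, each
equal to q whatever a is; only the phase of the level N still depends on a. -/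
lemma expSum_zero_eq (k q : ℕ) (hq : q ≠ 0) (N : ℤ) :
    expSum k N q 0 = (q : ℂ) ^ k * ramanujanSum N q := by
  rw [expSum, ramanujanSum, Finset.mul_sum]
  refine Finset.sum_congr rfl fun a ha => ?_
  have hco := (Finset.mem_filter.1 ha).2
  have h1 (b : Fin k ⊕ Fin k → Fin q) :
      expQ q ((a : ℝ) * Ft N (intVec (fun i => ((b i : ℕ) : ℤ)))
        + dot (intVec (0 : Fin k ⊕ Fin k → ℤ)) (intVec (fun i => ((b i : ℕ) : ℤ))))
      = expQ q (-((a : ℝ) * N)) * ∏ i : Fin k,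
          expQ q ((a : ℝ) * (((b (Sum.inl i) : ℕ) : ℝ) * ((b (Sum.inr i) : ℕ) : ℝ))) := by
    rw [← expQ_sum, ← expQ_add]
    congr 1
    simp [Ft, F0, dot, intVec, ← Finset.mul_sum]
    ring
  simp_rw [h1]
  rw [← Finset.mul_sum, mul_comm]
  congr 1
  -- Reindex b as a family of k pairs (x_l, y_l), so that the sum of products becomes a product of
  -- sums.
  rw [← ((Equiv.arrowProdEquivProdArrow (Fin k) (fun _ => Fin q) (fun _ => Fin q)).trans
    (Equiv.sumArrowEquivProdArrow (Fin k) (Fin k) (Fin q)).symm).sum_comp]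
  have h2 := Finset.prod_univ_sum (fun _ : Fin k => (Finset.univ : Finset (Fin q × Fin q)))
    (fun _ p => expQ q ((a : ℝ) * (((p.1 : ℕ) : ℝ) * ((p.2 : ℕ) : ℝ))))
  rw [Fintype.piFinset_univ] at h2
  simp only [sum_sum_expQ hq hco, Finset.prod_const, Finset.card_univ, Fintype.card_fin] at h2
  rw [h2]
  rfl

/-- The trivial bound is adequate: it is uniform in N, and for N = 0 the sum is Euler's φ(q), so
little is lost. -/
lemma norm_ramanujanSum_le (N : ℤ) (q : ℕ) : ‖ramanujanSum N q‖ ≤ q := by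
  refine (norm_sum_le _ _).trans ?_
  simp only [norm_expQ, Finset.sum_const, nsmul_eq_mul, mul_one]
  exact_mod_cast (Finset.card_filter_le _ _).trans (by simp)

lemma expQ_eq_zpow {q : ℕ} (a : ℕ) (N : ℤ) :
    expQ q (-((a : ℝ) * N)) = Complex.exp (2 * Real.pi * Complex.I * (a / q)) ^ (-N) := by
  rw [expQ, ← Complex.exp_int_mul]
  congr 1
  push_cast
  ring

lemma ramanujanSum_eq_sum_primitiveRoots (N : ℤ) {q : ℕ} (hq : q ≠ 0) :
    ramanujanSum N q = ∑ ζ ∈ primitiveRoots q ℂ, ζ ^ (-N) := by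
  rw [ramanujanSum]
  refine Finset.sum_bij (fun a _ => Complex.exp (2 * Real.pi * Complex.I * (a / q))) ?_ ?_ ?_ ?_
  · intro a ha
    rw [mem_primitiveRoots (Nat.pos_of_ne_zero hq)]
    exact Complex.isPrimitiveRoot_exp_of_coprime a q hq (Finset.mem_filter.1 ha).2
  · intro a ha b hb h
    have h0 := Complex.isPrimitiveRoot_exp q hq
    have key (c : ℕ) : Complex.exp (2 * Real.pi * Complex.I * (c / q))
        = Complex.exp (2 * Real.pi * Complex.I / q) ^ c := by
      rw [← Complex.exp_nat_mul]
      congr 1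
      ring
    simp only [key] at h
    exact h0.pow_inj (Finset.mem_range.1 (Finset.mem_filter.1 ha).1)
      (Finset.mem_range.1 (Finset.mem_filter.1 hb).1) h
  · intro ζ hζ
    rw [mem_primitiveRoots (Nat.pos_of_ne_zero hq), Complex.isPrimitiveRoot_iff ζ q hq] at hζ
    obtain ⟨i, hi, hc, h⟩ := hζ
    exact ⟨i, Finset.mem_filter.2 ⟨Finset.mem_range.2 hi, hc⟩, h⟩
  · intro a _
    exact expQ_eq_zpow a N

/-- The q-th roots of unity split according to their exact order e ∣ q, and the power sum over all
of them is a geometric sum. -/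
lemma sum_divisors_ramanujanSum (N : ℤ) {q : ℕ} (hq : 0 < q) :
    ∑ e ∈ q.divisors, ramanujanSum N e = if (q : ℤ) ∣ N then (q : ℂ) else 0 := by
  classical
  have h1 : ∑ e ∈ q.divisors, ramanujanSum N e
      = ∑ ζ ∈ Polynomial.nthRootsFinset q (1 : ℂ), ζ ^ (-N) := by
    rw [IsPrimitiveRoot.nthRoots_one_eq_biUnion_primitiveRoots, Finset.sum_biUnion]
    · exact Finset.sum_congr rfl fun e he =>
        ramanujanSum_eq_sum_primitiveRoots N (Nat.pos_of_mem_divisors he).ne'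
    · intro a _ b _ hab
      exact IsPrimitiveRoot.disjoint hab
  have h2 := sum_range_expQ hq.ne' (-N)
  simp only [dvd_neg] at h2
  rw [h1, ← h2]
  symm
  have hp := Complex.isPrimitiveRoot_exp q hq.ne'
  refine Finset.sum_bij (fun a _ => Complex.exp (2 * Real.pi * Complex.I / q) ^ a) ?_ ?_ ?_ ?_
  · intro a _
    rw [Polynomial.mem_nthRootsFinset hq, pow_right_comm, hp.pow_eq_one, one_pow]
  · intro a ha b hb h
    exact hp.pow_inj (Finset.mem_range.1 ha) (Finset.mem_range.1 hb) h
  · intro ζ hζ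
    rw [Polynomial.mem_nthRootsFinset hq] at hζ
    have : NeZero q := ⟨hq.ne'⟩
    obtain ⟨i, hi, h⟩ := hp.eq_pow_of_pow_eq_one hζ
    exact ⟨i, Finset.mem_range.2 hi, h⟩
  · intro a _
    have := expQ_eq_zpow (q := q) a N
    rw [← Complex.exp_nat_mul]
    convert this using 2
    · push_cast
      ring
    · congr 1
      ring

/-- The arithmetic function `q ↦ q` if `q ∣ N` and `0` otherwise. -/
def divisorIndicator (N : ℤ) : ArithmeticFunction ℂ :=
  ⟨fun q => if (q : ℤ) ∣ N then (q : ℂ) else 0, by simp⟩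

lemma isMultiplicative_divisorIndicator (N : ℤ) : (divisorIndicator N).IsMultiplicative := by
  refine ⟨by simp [divisorIndicator], fun {m n} h => ?_⟩
  simp only [divisorIndicator, ArithmeticFunction.coe_mk]
  have : ((m * n : ℕ) : ℤ) ∣ N ↔ (m : ℤ) ∣ N ∧ (n : ℤ) ∣ N := by
    push_cast
    exact ⟨fun h' => ⟨dvd_of_mul_right_dvd h', dvd_of_mul_left_dvd h'⟩,
      fun h' => IsCoprime.mul_dvd (Nat.isCoprime_iff_coprime.2 h) h'.1 h'.2⟩
  simp only [this]
  split_ifs <;> simp_all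

lemma ramanujanSum_eq_convolution (N : ℤ) {q : ℕ} (hq : 0 < q) :
    ramanujanSum N q = ((ArithmeticFunction.moebius : ArithmeticFunction ℂ) * divisorIndicator N) q := by
  have h := (ArithmeticFunction.sum_eq_iff_sum_mul_moebius_eq (f := ramanujanSum N)
    (g := fun q => if (q : ℤ) ∣ N then (q : ℂ) else 0)).1
    (fun n hn => sum_divisors_ramanujanSum N hn) q hq
  rw [← h, ArithmeticFunction.mul_apply]
  rfl

/-- Möbius inversion of the divisor sum writes c_q(N) as a Dirichlet convolution of two
multiplicative functions. -/
lemma ramanujanSum_mul (N : ℤ) {m n : ℕ} (h : Nat.Coprime m n) :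
    ramanujanSum N (m * n) = ramanujanSum N m * ramanujanSum N n := by
  rcases Nat.eq_zero_or_pos m with rfl | hm
  · simp [ramanujanSum]
  rcases Nat.eq_zero_or_pos n with rfl | hn
  · simp [ramanujanSum]
  rw [ramanujanSum_eq_convolution N hm, ramanujanSum_eq_convolution N hn,
    ramanujanSum_eq_convolution N (Nat.mul_pos hm hn)]
  refine ((ArithmeticFunction.isMultiplicative_moebius.intCast).mul
    (isMultiplicative_divisorIndicator N)).map_mul_of_coprime h

/-- The `q`-th term `q^{-d} S_q(0)` of the singular series. -/
def singularTerm (k : ℕ) (N : ℤ) (q : ℕ) : ℂ := ((q : ℂ) ^ k)⁻¹ * ramanujanSum N q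

lemma singularTerm_eq (k : ℕ) (N : ℤ) {q : ℕ} (hq : q ≠ 0) :
    ((q : ℂ) ^ (2 * k))⁻¹ * expSum k N q 0 = singularTerm k N q := by
  have hq' : (q : ℂ) ≠ 0 := by exact_mod_cast hq
  rw [expSum_zero_eq k q hq, singularTerm, two_mul, pow_add]
  field_simp

lemma norm_singularTerm_le (k : ℕ) (N : ℤ) (q : ℕ) :
    ‖singularTerm k N q‖ ≤ ((q : ℝ) ^ k)⁻¹ * q := by
  rw [singularTerm, norm_mul, norm_inv, norm_pow, Complex.norm_natCast]
  gcongr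
  exact norm_ramanujanSum_le N q

lemma summable_norm_singularTerm {k : ℕ} (hk : 3 ≤ k) (N : ℤ) :
    Summable (fun q => ‖singularTerm k N q‖) := by
  refine Summable.of_nonneg_of_le (fun _ => norm_nonneg _) (fun q => ?_)
    (Real.summable_nat_pow_inv.2 (by norm_num : 1 < 2))
  refine (norm_singularTerm_le k N q).trans ?_
  rcases Nat.eq_zero_or_pos q with rfl | hq
  · simp
  have h1 : (1 : ℝ) ≤ q := by exact_mod_cast hq
  rw [inv_mul_le_iff₀ (by positivity)]
  calc (q : ℝ) = (q : ℝ) ^ 3 * ((q : ℝ) ^ 2)⁻¹ := by field_simp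
    _ ≤ (q : ℝ) ^ k * ((q : ℝ) ^ 2)⁻¹ := by gcongr

lemma sigmaPTerm_eq (k : ℕ) (N : ℤ) (p : Nat.Primes) (l : ℕ) :
    sigmaPTerm k N p l = singularTerm k N ((p : ℕ) ^ l) := by
  rw [← singularTerm_eq k N (pow_ne_zero l p.2.ne_zero), sigmaPTerm]
  congr 2
  push_cast
  rw [← pow_mul]
  congr 1
  ring

lemma summable_sigmaPTerm {k : ℕ} (hk : 3 ≤ k) (N : ℤ) (p : Nat.Primes) :
    Summable (sigmaPTerm k N p) := by
  have h := (summable_norm_singularTerm hk N).comp_injective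
    (Nat.pow_right_injective p.2.two_le)
  refine Summable.of_norm (h.congr fun l => ?_)
  rw [sigmaPTerm_eq]
  rfl

/-- Euler product of an absolutely summable multiplicative function; `HasProd` carries the
unconditional convergence along with the value. -/
lemma hasProd_sigmaP {k : ℕ} (hk : 3 ≤ k) (N : ℤ) :
    HasProd (fun p : Nat.Primes => sigmaP k N p) (∑' q : ℕ, singularTerm k N q) := by
  have h := EulerProduct.eulerProduct_hasProd (f := singularTerm k N)
    (by simp [singularTerm, ramanujanSum, expQ_zero])
    (fun {m n} hmn => by
      simp only [singularTerm, ramanujanSum_mul N hmn]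
      push_cast
      rw [mul_pow, mul_inv]
      ring)
    (summable_norm_singularTerm hk N) (by simp [singularTerm, ramanujanSum])
  convert h using 2 with p
  exact tsum_congr fun l => sigmaPTerm_eq k N p l

end

/-! ### The kernel of the delta method: decay, moments, reproduction of smooth functions. -/

section

open scoped ContDiff FourierTransform
open Filter Topology

lemma bump_eq_expNegInvGlue (x : ℝ) : bump x = expNegInvGlue (1 - x ^ 2) := by
  rw [bump, expNegInvGlue]
  have h : |x| < 1 ↔ ¬ (1 - x ^ 2 ≤ 0) := by
    rw [← sq_lt_one_iff_abs_lt_one]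
    constructor <;> intro h <;> linarith
  by_cases h1 : |x| < 1
  · rw [if_pos h1, if_neg (h.1 h1)]
    congr 1
    rw [one_div, ← neg_sub (1 : ℝ), inv_neg]
  · rw [if_neg h1, if_pos (not_not.1 (fun h2 => h1 (h.2 h2)))]

lemma contDiff_bump : ContDiff ℝ ∞ bump := by
  have : bump = fun x => expNegInvGlue (1 - x ^ 2) := funext bump_eq_expNegInvGlue
  rw [this]
  exact expNegInvGlue.contDiff.comp (contDiff_const.sub (contDiff_id.pow 2))

lemma bump_nonneg (x : ℝ) : 0 ≤ bump x := by
  rw [bump]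
  split_ifs <;> positivity

lemma bump_eq_zero {x : ℝ} (h : 1 ≤ |x|) : bump x = 0 := if_neg (not_lt.2 h)

lemma hasCompactSupport_bump : HasCompactSupport bump := by
  refine HasCompactSupport.intro (isCompact_Icc (a := (-1 : ℝ)) (b := 1)) fun x hx => ?_
  refine bump_eq_zero (not_lt.1 fun h => hx ?_)
  exact ⟨(abs_lt.1 h).1.le, (abs_lt.1 h).2.le⟩

lemma bumpMass_pos : 0 < bumpMass := by
  refine contDiff_bump.continuous.integral_pos_of_hasCompactSupport_nonneg_nonzero
    hasCompactSupport_bump bump_nonneg (x := 0) ?_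
  simp [bump]

lemma contDiff_omega : ContDiff ℝ ∞ omega := by
  unfold omega
  exact contDiff_const.mul (contDiff_bump.comp ((contDiff_const.mul contDiff_id).sub contDiff_const))

lemma omega_eq_zero_of_le {x : ℝ} (h : x ≤ 1 / 2) : omega x = 0 := by
  rw [omega, bump_eq_zero, mul_zero]
  rw [abs_of_nonpos] <;> linarith

lemma omega_eq_zero_of_ge {x : ℝ} (h : 1 ≤ x) : omega x = 0 := by
  rw [omega, bump_eq_zero, mul_zero]
  rw [abs_of_nonneg] <;> linarith

lemma hasCompactSupport_omega : HasCompactSupport omega := by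
  refine HasCompactSupport.intro (isCompact_Icc (a := (0 : ℝ)) (b := 1)) fun x hx => ?_
  by_cases h : x ≤ 1 / 2
  · exact omega_eq_zero_of_le h
  · exact omega_eq_zero_of_ge (not_lt.1 fun h' => hx ⟨by linarith, h'.le⟩)

lemma integral_omega : ∫ x, omega x = 1 := by
  have h0 := bumpMass_pos
  have h1 : ∫ x, bump (4 * x - 3) = 4⁻¹ * bumpMass := by
    have := Measure.integral_comp_mul_left (fun x => bump (x - 3)) 4
    rw [this, integral_sub_right_eq_self, abs_of_pos (by norm_num), smul_eq_mul]
    rfl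
  simp only [omega]
  rw [integral_const_mul, h1]
  field_simp

lemma fourier_scale (f : ℝ → ℂ) {T : ℝ} (hT : 0 < T) (m : ℝ) :
    𝓕 (fun x => f (x / T)) m = T * 𝓕 f (T * m) := by
  rw [Real.fourier_real_eq_integral_exp_smul, Real.fourier_real_eq_integral_exp_smul]
  have h := Measure.integral_comp_div
    (fun v : ℝ => Complex.exp (↑(-2 * Real.pi * v * (T * m)) * Complex.I) • f v) T
  rw [abs_of_pos hT] at h
  rw [← Complex.real_smul, ← h]
  congr 1
  ext v
  congr 4
  field_simp

lemma summable_int_div {B : ℝ → ℝ} (hs : HasCompactSupport B) {T : ℝ} (hT : 0 < T) :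
    Summable (fun n : ℤ => B (n / T)) := by
  obtain ⟨A, hA0, hA⟩ := hs.exists_pos_le_norm
  refine summable_of_hasFiniteSupport ((Set.finite_Icc (-⌈A * T⌉) ⌈A * T⌉).subset fun n hn => ?_)
  by_contra hcon
  refine hn (hA _ ?_)
  rw [Real.norm_eq_abs, abs_div, abs_of_pos hT, le_div_iff₀ hT]
  refine (Int.le_ceil _).trans ?_
  rw [← Int.cast_abs]
  refine Int.cast_le.2 (not_lt.1 fun h => hcon ?_)
  exact ⟨(abs_lt.1 h).1.le, (abs_lt.1 h).2.le⟩

/-- Riemann sums of an even smooth function of compact support converge faster than any power. -/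
lemma exists_tsum_pnat_sub_integral_le {B : ℝ → ℝ} (hB : ContDiff ℝ ∞ B) (hs : HasCompactSupport B)
    (he : ∀ x, B (-x) = B x) (N : ℕ) :
    ∃ C : ℝ, 0 ≤ C ∧ ∀ T : ℝ, 0 < T →
      |∑' j : ℕ+, B (j / T) - (T * (2⁻¹ * ∫ x, B x) - B 0 / 2)| ≤ C / T ^ (N + 1) := by
  have hsC : HasCompactSupport (fun x => (B x : ℂ)) := hs.comp_left (g := fun x : ℝ => (x : ℂ)) rfl
  have hBC : ContDiff ℝ ∞ (fun x => (B x : ℂ)) := Complex.ofRealCLM.contDiff.comp hB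
  let F := hsC.toSchwartzMap hBC
  have hF : (F : ℝ → ℂ) = fun x => (B x : ℂ) := rfl
  -- Decay of order N + 2: rescaling by T costs one factor T, which leaves T^{-(N+1)} and a summable
  -- |n|^{-(N+2)}.
  obtain ⟨D, hD0, hD⟩ := (𝓕 F).decay (N + 2) 0
  have hsum : Summable (fun n : ℤ => 1 / |(n : ℝ)| ^ (N + 2)) := by
    have := Real.summable_abs_int_rpow (b := N + 2) (by
      have := N.cast_nonneg (α := ℝ)
      linarith)
    refine this.congr fun n => ?_
    rw [one_div, Real.rpow_neg (abs_nonneg _)]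
    norm_cast
  refine ⟨D * ∑' n : ℤ, 1 / |(n : ℝ)| ^ (N + 2), mul_nonneg hD0.le (tsum_nonneg fun n => by positivity), ?_⟩
  intro T hT
  have hsT : HasCompactSupport (fun x => (B (x / T) : ℂ)) := by
    have := hsC.comp_homeomorph (Homeomorph.mulRight₀ T⁻¹ (inv_ne_zero hT.ne'))
    simpa [Function.comp_def, div_eq_mul_inv] using this
  have hBT : ContDiff ℝ ∞ (fun x => (B (x / T) : ℂ)) := hBC.comp (contDiff_id.div_const T)
  let G := hsT.toSchwartzMap hBT
  -- Poisson summation for B(·/T): the zero frequency is the integral, the others form the error;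
  -- evenness later folds the sum over ℤ onto j ≥ 1.
  have hpois := G.tsum_eq_tsum_fourier 0
  have hG (n : ℤ) : (𝓕 G) (n : ℝ) = (T : ℂ) * (𝓕 F) (T * n) := by
    rw [SchwartzMap.fourier_coe, SchwartzMap.fourier_coe]
    exact fourier_scale (fun x => (B x : ℂ)) hT n
  have hbd (n : ℤ) (hn : n ≠ 0) :
      ‖(𝓕 G) (n : ℝ)‖ ≤ D / T ^ (N + 1) * (1 / |(n : ℝ)| ^ (N + 2)) := by
    have h1 := hD (T * n)
    rw [norm_iteratedFDeriv_zero, Real.norm_eq_abs, abs_mul, abs_of_pos hT] at h1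
    have hn' : 0 < |(n : ℝ)| := abs_pos.2 (by exact_mod_cast hn)
    rw [hG, norm_mul, Complex.norm_real, Real.norm_eq_abs, abs_of_pos hT]
    rw [← le_div_iff₀' (by positivity)] at h1
    calc T * ‖(𝓕 F) (T * n)‖ ≤ T * (D / (T * |(n : ℝ)|) ^ (N + 2)) := by gcongr
      _ = _ := by
        rw [mul_pow]
        field_simp
        ring
  have hsG : Summable (fun n : ℤ => (𝓕 G) (n : ℝ)) := by
    refine Summable.of_norm_bounded_eventually (hsum.mul_left (D / T ^ (N + 1))) ?_
    filter_upwards [(Set.finite_singleton (0 : ℤ)).compl_mem_cofinite] with n hn using hbd n hn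
  have h0 : (𝓕 G) ((0 : ℤ) : ℝ) = ((T * ∫ x, B x : ℝ) : ℂ) := by
    rw [hG, SchwartzMap.fourier_coe, hF, Real.fourier_real_eq_integral_exp_smul]
    simp [integral_complex_ofReal]
  simp only [zero_add, QuotientAddGroup.mk_zero, fourier_eval_zero, mul_one] at hpois
  rw [hsG.tsum_eq_add_tsum_ite 0, h0] at hpois
  have hL : ∑' n : ℤ, G n = ((B 0 + 2 * ∑' j : ℕ+, B (j / T) : ℝ) : ℂ) := by
    have h2 := tsum_int_eq_zero_add_two_mul_tsum_pnat (f := fun n : ℤ => B (n / T))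
      (fun n => by simp [neg_div, he]) (summable_int_div hs hT)
    simp only [Int.cast_zero, zero_div, Int.cast_natCast, nsmul_eq_mul, Nat.cast_ofNat] at h2
    rw [← h2, Complex.ofReal_tsum]
    rfl
  rw [hL] at hpois
  have hbound : ‖∑' n : ℤ, (if n = 0 then 0 else (𝓕 G) (n : ℝ))‖
      ≤ D / T ^ (N + 1) * ∑' n : ℤ, 1 / |(n : ℝ)| ^ (N + 2) := by
    refine tsum_of_norm_bounded (hsum.hasSum.mul_left _) fun n => ?_
    split_ifs with h
    · simp only [norm_zero]
      positivity
    · exact hbd n h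
  have h3 : ∑' n : ℤ, (if n = 0 then 0 else (𝓕 G) (n : ℝ))
      = ((2 * (∑' j : ℕ+, B (j / T) - (T * (2⁻¹ * ∫ x, B x) - B 0 / 2)) : ℝ) : ℂ) := by
    push_cast at hpois ⊢
    linear_combination -hpois
  rw [h3, Complex.norm_real, Real.norm_eq_abs, abs_mul, abs_two] at hbound
  rw [mul_div_right_comm]
  linarith [abs_nonneg (∑' j : ℕ+, B (j / T) - (T * (2⁻¹ * ∫ x, B x) - B 0 / 2))]

/-- One-sided version, for functions that vanish on the negative half-line. -/
lemma exists_tsum_pnat_sub_integral_le_of_nonpos {f : ℝ → ℝ} (hf : ContDiff ℝ ∞ f)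
    (hs : HasCompactSupport f) (h0 : ∀ x ≤ 0, f x = 0) (N : ℕ) :
    ∃ C : ℝ, 0 ≤ C ∧ ∀ T : ℝ, 0 < T →
      |∑' j : ℕ+, f (j / T) - T * ∫ x, f x| ≤ C / T ^ (N + 1) := by
  have hs' : HasCompactSupport (fun x => f (-x)) := hs.comp_homeomorph (Homeomorph.neg ℝ)
  have hint : Integrable f := hf.continuous.integrable_of_hasCompactSupport hs
  -- The symmetrisation is even, vanishes at 0 and has twice the integral, while its reflected half
  -- is zero at the sample points.
  obtain ⟨C, hC, h⟩ := exists_tsum_pnat_sub_integral_le (B := fun x => f x + f (-x))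
    (hf.add (hf.comp contDiff_neg)) (hs.add hs') (fun x => by rw [neg_neg, add_comm]) N
  refine ⟨C, hC, fun T hT => ?_⟩
  have h1 := h T hT
  rw [integral_add hint hint.comp_neg, integral_neg_eq_self] at h1
  simp only [neg_zero, h0 0 le_rfl, add_zero, zero_div, sub_zero] at h1
  have h2 (j : ℕ+) : f (-((j : ℝ) / T)) = 0 := h0 _ (by
    have : (0 : ℝ) < j := by exact_mod_cast j.pos
    have := div_pos this hT
    linarith)
  simp only [h2, add_zero] at h1
  rwa [← two_mul, inv_mul_cancel_left₀ two_ne_zero] at h1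

/-- `∑_j ω(|u|/j)/j`, so that `h₂(x, y)` is `x⁻¹` times its value at `y/x`. -/
def kernelSum (u : ℝ) : ℝ := ∑' j : ℕ+, 1 / (j : ℝ) * omega (|u| / j)

/-- `∑_j ω(xj)/j`, so that `h₁(x)` is `x⁻¹` times this sum. -/
def omegaSum (x : ℝ) : ℝ := ∑' j : ℕ+, 1 / (j : ℝ) * omega (x * j)

/-- `∫ ω(v) dv/v`, the common limit of `kernelSum` at infinity and of `omegaSum` at zero. -/
def omegaLogMass : ℝ := ∫ v, omega v / v

/-- The rapidly decaying kernel whose rescalings approximate `h(x, ·)`. -/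
def deltaKernel (u : ℝ) : ℝ := omegaLogMass - kernelSum u

/-- Both x·h₁ and x·h₂ are Riemann sums with the limit `omegaLogMass`, the first as x → 0 and the
second as |t|/x → ∞. Subtracting this limit from each isolates a rapidly decaying kernel in t/x and
a remainder that is independent of t and small in x. -/
lemma hFun_eq {x : ℝ} (hx : 0 < x) (t : ℝ) :
    hFun x t = x⁻¹ * deltaKernel (t / x) + x⁻¹ * (omegaSum x - omegaLogMass) := by
  have h1 : hOne x = x⁻¹ * omegaSum x := by
    rw [hOne, omegaSum, ← tsum_mul_left]
    refine tsum_congr fun j => ?_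
    field_simp
  have h2 : hTwo x t = x⁻¹ * kernelSum (t / x) := by
    rw [hTwo, kernelSum, ← tsum_mul_left]
    refine tsum_congr fun j => ?_
    rw [abs_div, abs_of_pos hx, div_div]
    field_simp
  rw [hFun, h1, h2, deltaKernel]
  ring

lemma contDiff_omega_div : ContDiff ℝ ∞ (fun v => omega v / v) := by
  rw [contDiff_iff_contDiffAt]
  intro v
  rcases eq_or_ne v 0 with rfl | hv
  · refine (contDiffAt_const (c := (0 : ℝ))).congr_of_eventuallyEq ?_
    filter_upwards [Iio_mem_nhds (show (0 : ℝ) < 1 / 2 by norm_num)] with y hy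
    rw [omega_eq_zero_of_le (le_of_lt hy), zero_div]
  · exact contDiff_omega.contDiffAt.div contDiffAt_id hv

lemma omega_inv_eq_zero {r : ℝ} (h : r ≤ 1) : omega r⁻¹ = 0 := by
  rcases le_or_gt r 0 with h0 | h0
  · exact omega_eq_zero_of_le ((inv_nonpos.2 h0).trans (by norm_num))
  · exact omega_eq_zero_of_ge ((one_le_inv₀ h0).2 h)

lemma contDiff_omega_inv_div : ContDiff ℝ ∞ (fun r => omega r⁻¹ / r) := by
  rw [contDiff_iff_contDiffAt]
  intro r
  rcases eq_or_ne r 0 with rfl | hr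
  · refine (contDiffAt_const (c := (0 : ℝ))).congr_of_eventuallyEq ?_
    filter_upwards [Iio_mem_nhds (show (0 : ℝ) < 1 by norm_num)] with y hy
    rw [omega_inv_eq_zero (le_of_lt hy), zero_div]
  · exact (contDiff_omega.contDiffAt.comp r (contDiffAt_inv ℝ hr)).div contDiffAt_id hr

lemma hasCompactSupport_omega_div : HasCompactSupport (fun v => omega v / v) := by
  have := hasCompactSupport_omega.mul_right (f' := fun v : ℝ => v⁻¹)
  simpa [div_eq_mul_inv, Pi.mul_def] using this

lemma hasCompactSupport_omega_inv_div : HasCompactSupport (fun r => omega r⁻¹ / r) := by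
  refine HasCompactSupport.intro (isCompact_Icc (a := (0 : ℝ)) (b := 2)) fun r hr => ?_
  by_cases h : r ≤ 1
  · rw [omega_inv_eq_zero h, zero_div]
  · have h2 : 2 < r := not_le.1 fun h' => hr ⟨by linarith, h'⟩
    rw [omega_eq_zero_of_le, zero_div]
    rw [inv_eq_one_div]
    exact one_div_le_one_div_of_le (by norm_num) h2.le

/-- The measure dv/v is invariant under v ↦ 1/v; hence the two Riemann sums share one limit. -/
lemma integral_omega_inv_div : ∫ r, omega r⁻¹ / r = omegaLogMass := by
  have h1 : ∫ r, omega r⁻¹ / r = ∫ r in Set.Ioi 0, omega r⁻¹ / r :=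
    (setIntegral_eq_integral_of_forall_compl_eq_zero fun r hr => by
      rw [omega_inv_eq_zero ((not_lt.1 hr).trans zero_le_one), zero_div]).symm
  have h2 : omegaLogMass = ∫ v in Set.Ioi 0, omega v / v :=
    (setIntegral_eq_integral_of_forall_compl_eq_zero fun r hr => by
      rw [omega_eq_zero_of_le ((not_lt.1 hr).trans (by norm_num)), zero_div]).symm
  rw [h1, h2, ← integral_comp_rpow_Ioi (fun v => omega v / v) (p := -1) (by norm_num)]
  refine setIntegral_congr_fun measurableSet_Ioi fun r hr => ?_
  have hr' : (0 : ℝ) < r := hr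
  simp only [abs_neg, abs_one, one_mul, smul_eq_mul, Real.rpow_neg_one]
  rw [show (-1 - 1 : ℝ) = -((2 : ℕ) : ℝ) by norm_num, Real.rpow_neg hr'.le, Real.rpow_natCast]
  field_simp

/-- `omegaSum` differs from its limit at zero by `O(x^N)`, for all `x > 0`. -/
lemma exists_omegaSum_sub_le (N : ℕ) :
    ∃ C : ℝ, 0 ≤ C ∧ ∀ x : ℝ, 0 < x → |omegaSum x - omegaLogMass| ≤ C * x ^ N := by
  obtain ⟨C, hC, h⟩ := exists_tsum_pnat_sub_integral_le_of_nonpos contDiff_omega_div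
    hasCompactSupport_omega_div
    (fun x hx => by rw [omega_eq_zero_of_le (hx.trans (by norm_num)), zero_div]) N
  refine ⟨C + |omegaLogMass|, by positivity, fun x hx => ?_⟩
  -- For x ≥ 1 all xj lie beyond the support of ω and only the constant limit remains. For x < 1 the
  -- sum is x times a Riemann sum of ω(v)/v with T = 1/x.
  rcases le_or_gt 1 x with hx1 | hx1
  · have h0 : omegaSum x = 0 := by
      rw [omegaSum]
      convert tsum_zero with j
      rw [omega_eq_zero_of_ge, mul_zero]
      have : (1 : ℝ) ≤ j := by exact_mod_cast j.pos
      nlinarith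
    rw [h0, zero_sub, abs_neg]
    have : (1 : ℝ) ≤ x ^ N := one_le_pow₀ hx1
    nlinarith [abs_nonneg omegaLogMass]
  · have h1 := h x⁻¹ (inv_pos.2 hx)
    have h2 : omegaSum x = x * ∑' j : ℕ+, omega ((j : ℝ) / x⁻¹) / ((j : ℝ) / x⁻¹) := by
      rw [omegaSum, ← tsum_mul_left]
      refine tsum_congr fun j => ?_
      rw [div_inv_eq_mul, mul_comm x]
      field_simp
    have h3 : omegaSum x - omegaLogMass
        = x * (∑' j : ℕ+, omega ((j : ℝ) / x⁻¹) / ((j : ℝ) / x⁻¹) - x⁻¹ * ∫ v, omega v / v) := by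
      rw [h2, mul_sub, mul_inv_cancel_left₀ hx.ne']
      rfl
    rw [h3, abs_mul, abs_of_pos hx]
    calc x * _ ≤ x * (C / x⁻¹ ^ (N + 1)) := by gcongr
      _ = C * x ^ N * x ^ 2 := by
        rw [inv_pow, div_inv_eq_mul]
        ring
      _ ≤ C * x ^ N * 1 := by
        gcongr
        exact pow_le_one₀ hx.le hx1.le
      _ ≤ (C + |omegaLogMass|) * x ^ N := by
        rw [mul_one]
        gcongr
        linarith [abs_nonneg omegaLogMass]

/-- Terms with j ≥ 2|u| vanish. On bounded sets of u one finite sum therefore serves for all u,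
which gives continuity and integration term by term. -/
lemma kernelSum_eq_sum {u : ℝ} {M : ℕ} (h : 2 * |u| ≤ M) :
    kernelSum u = ∑ j ∈ Finset.range M, 1 / ((j + 1 : ℕ) : ℝ) * omega (|u| / (j + 1 : ℕ)) := by
  rw [kernelSum, tsum_pnat_eq_tsum_succ (f := fun j : ℕ => 1 / (j : ℝ) * omega (|u| / j))]
  refine tsum_eq_sum fun j hj => ?_
  have hj' : (M : ℝ) ≤ j := by exact_mod_cast not_lt.1 (fun h' => hj (Finset.mem_range.2 h'))
  rw [omega_eq_zero_of_le, mul_zero]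
  rw [div_le_iff₀ (by positivity)]
  push_cast
  linarith

lemma continuous_deltaKernel : Continuous deltaKernel := by
  rw [continuous_iff_continuousAt]
  intro u
  obtain ⟨M, hM⟩ := exists_nat_ge (2 * (|u| + 1))
  have h1 : ∀ᶠ v in 𝓝 u, deltaKernel v = omegaLogMass
      - ∑ j ∈ Finset.range M, 1 / ((j + 1 : ℕ) : ℝ) * omega (|v| / (j + 1 : ℕ)) := by
    filter_upwards [Metric.ball_mem_nhds u one_pos] with v hv
    rw [deltaKernel, kernelSum_eq_sum]
    rw [Real.ball_eq_Ioo] at hv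
    have : |v| ≤ |u| + 1 := by
      have h2 : |v - u| < 1 := abs_sub_lt_iff.2 ⟨by linarith [hv.2], by linarith [hv.1]⟩
      have h3 := abs_add_le u (v - u)
      rw [add_sub_cancel] at h3
      linarith
    linarith
  refine ContinuousAt.congr ?_ (h1.mono fun _ h => h.symm)
  have := contDiff_omega.continuous
  exact Continuous.continuousAt (by fun_prop)

lemma deltaKernel_neg (u : ℝ) : deltaKernel (-u) = deltaKernel u := by
  simp [deltaKernel, kernelSum]

lemma deltaKernel_abs (u : ℝ) : deltaKernel |u| = deltaKernel u := by
  simp [deltaKernel, kernelSum]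

/-- The kernel decays faster than any power. -/
lemma exists_pow_mul_deltaKernel_le (N : ℕ) :
    ∃ C : ℝ, 0 ≤ C ∧ ∀ u : ℝ, |u| ^ N * |deltaKernel u| ≤ C := by
  obtain ⟨C, hC, h⟩ := exists_tsum_pnat_sub_integral_le_of_nonpos contDiff_omega_inv_div
    hasCompactSupport_omega_inv_div
    (fun x hx => by rw [omega_inv_eq_zero (hx.trans zero_le_one), zero_div]) N
  refine ⟨4 * C + |omegaLogMass|, by positivity, fun u => ?_⟩
  rw [← deltaKernel_abs]
  rcases le_or_gt |u| (1 / 2) with hu | hu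
  · have h0 : kernelSum |u| = 0 := by
      rw [kernelSum]
      convert tsum_zero with j
      rw [omega_eq_zero_of_le, mul_zero]
      have : (1 : ℝ) ≤ j := by exact_mod_cast j.pos
      rw [abs_abs, div_le_iff₀ (by positivity)]
      linarith
    rw [deltaKernel, h0, sub_zero]
    have h1 : |u| ^ N ≤ 1 := pow_le_one₀ (abs_nonneg u) (hu.trans (by norm_num))
    nlinarith [abs_nonneg omegaLogMass]
  · have hu0 : 0 < |u| := by linarith
    have h1 := h |u| hu0
    rw [integral_omega_inv_div] at h1
    -- With T = |u| this is a Riemann sum of ω(1/r)/r, to which the Poisson estimate applies.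
    have h2 : kernelSum |u| = |u|⁻¹ * ∑' j : ℕ+, omega ((j : ℝ) / |u|)⁻¹ / ((j : ℝ) / |u|) := by
      rw [kernelSum, ← tsum_mul_left]
      refine tsum_congr fun j => ?_
      rw [inv_div, abs_abs]
      field_simp
    have h3 : deltaKernel |u| = -(|u|⁻¹ *
        (∑' j : ℕ+, omega ((j : ℝ) / |u|)⁻¹ / ((j : ℝ) / |u|) - |u| * omegaLogMass)) := by
      rw [deltaKernel, h2, mul_sub, inv_mul_cancel_left₀ hu0.ne']
      ring
    rw [h3, abs_neg, abs_mul, abs_inv, abs_abs]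
    calc |u| ^ N * (|u|⁻¹ * _) ≤ |u| ^ N * (|u|⁻¹ * (C / |u| ^ (N + 1))) := by gcongr
      _ = C / |u| ^ 2 := by
        field_simp
        ring
      _ ≤ C / (1 / 2) ^ 2 := by gcongr
      _ ≤ 4 * C + |omegaLogMass| := by
        have : C / (1 / 2) ^ 2 = 4 * C := by ring
        linarith [abs_nonneg omegaLogMass]

lemma integrable_pow_mul_deltaKernel (N : ℕ) : Integrable (fun u => u ^ N * deltaKernel u) := by
  obtain ⟨C, hC, h⟩ := exists_pow_mul_deltaKernel_le N
  obtain ⟨D, hD, h'⟩ := exists_pow_mul_deltaKernel_le (N + 2)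
  have hm : AEStronglyMeasurable (fun u => u ^ N * deltaKernel u) volume := by
    have := continuous_deltaKernel
    exact Continuous.aestronglyMeasurable (by fun_prop)
  refine (integrable_inv_one_add_sq.const_mul (C + D)).mono' hm (Eventually.of_forall fun u => ?_)
  rw [Real.norm_eq_abs, abs_mul, abs_pow, ← div_eq_mul_inv, le_div_iff₀ (by positivity)]
  have h1 := h u
  have h2 := h' u
  rw [pow_add, sq_abs] at h2
  nlinarith

/-- The truncated moments `∫_0^v t^i ω(t) dt`. -/
def omegaMoment (i : ℕ) (v : ℝ) : ℝ := ∫ t in (0 : ℝ)..v, t ^ i * omega t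

lemma continuous_pow_mul_omega (i : ℕ) : Continuous (fun t : ℝ => t ^ i * omega t) :=
  (continuous_pow i).mul contDiff_omega.continuous

lemma contDiff_omegaMoment (i : ℕ) : ContDiff ℝ ∞ (omegaMoment i) := by
  have h (v : ℝ) : HasDerivAt (omegaMoment i) (v ^ i * omega v) v :=
    (continuous_pow_mul_omega i).integral_hasStrictDerivAt 0 v |>.hasDerivAt
  rw [contDiff_infty_iff_deriv]
  refine ⟨fun v => (h v).differentiableAt, ?_⟩
  rw [funext fun v => (h v).deriv]
  exact (contDiff_id.pow i).mul contDiff_omega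

lemma omegaMoment_eq_zero {i : ℕ} {v : ℝ} (h : v ≤ 1 / 2) : omegaMoment i v = 0 := by
  refine intervalIntegral.integral_zero_ae (Eventually.of_forall fun t ht => ?_)
  rw [omega_eq_zero_of_le, mul_zero]
  rcases Set.mem_uIoc.1 ht with h1 | h1
  · exact h1.2.trans h
  · exact h1.2.trans (by norm_num)

lemma omegaMoment_eq_of_ge {i : ℕ} {v : ℝ} (h : 1 ≤ v) : omegaMoment i v = omegaMoment i 1 := by
  have hi (a b : ℝ) := (continuous_pow_mul_omega i).intervalIntegrable (μ := volume) a b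
  rw [omegaMoment, ← intervalIntegral.integral_add_adjacent_intervals (hi 0 1) (hi 1 v), omegaMoment]
  simp only [add_eq_left]
  refine intervalIntegral.integral_zero_ae (Eventually.of_forall fun t ht => ?_)
  rw [Set.uIoc_of_le h] at ht
  rw [omega_eq_zero_of_ge ht.1.le, mul_zero]

lemma omegaMoment_zero_one : omegaMoment 0 1 = 1 := by
  rw [omegaMoment, intervalIntegral.integral_of_le zero_le_one]
  simp only [pow_zero, one_mul]
  refine Eq.trans ?_ integral_omega
  refine setIntegral_eq_integral_of_forall_compl_eq_zero fun t ht => ?_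
  rcases le_or_gt t 0 with h | h
  · exact omega_eq_zero_of_le (h.trans (by norm_num))
  · exact omega_eq_zero_of_ge (not_lt.1 fun h1 => ht ⟨h, h1.le⟩)

/-- The smooth function `r ↦ r^i ∫_0^{1/|r|} t^i ω(t) dt`. -/
def momentBump (i : ℕ) (r : ℝ) : ℝ :=
  if |r| < 1 then r ^ i * omegaMoment i 1 else r ^ i * omegaMoment i |r|⁻¹

lemma momentBump_eq {i : ℕ} {r : ℝ} (hr : r ≠ 0) :
    momentBump i r = r ^ i * omegaMoment i |r|⁻¹ := by
  rw [momentBump]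
  split_ifs with h
  · rw [omegaMoment_eq_of_ge ((one_le_inv₀ (abs_pos.2 hr)).2 h.le)]
  · rfl

lemma momentBump_eq_zero {i : ℕ} {r : ℝ} (hr : 2 ≤ |r|) : momentBump i r = 0 := by
  rw [momentBump_eq (abs_pos.1 (by linarith)), omegaMoment_eq_zero, mul_zero]
  rw [inv_eq_one_div]
  exact one_div_le_one_div_of_le (by norm_num) hr

/-- Near r = 0 the upper limit 1/|r| has passed the support of ω, so the function is a monomial
there; elsewhere |r| is smooth. -/
lemma contDiff_momentBump (i : ℕ) : ContDiff ℝ ∞ (momentBump i) := by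
  rw [contDiff_iff_contDiffAt]
  intro r
  rcases eq_or_ne r 0 with rfl | hr
  · refine ((contDiff_id.pow i).mul (contDiff_const (c := omegaMoment i 1))).contDiffAt.congr_of_eventuallyEq ?_
    filter_upwards [Metric.ball_mem_nhds (0 : ℝ) one_pos] with y hy
    rw [mem_ball_zero_iff, Real.norm_eq_abs] at hy
    exact if_pos hy
  · have h : ContDiffAt ℝ ∞ (fun y : ℝ => y ^ i * omegaMoment i |y|⁻¹) r :=
      (contDiffAt_id.pow i).mul ((contDiff_omegaMoment i).contDiffAt.comp r
        ((contDiffAt_abs hr).inv (abs_ne_zero.2 hr)))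
    refine h.congr_of_eventuallyEq ?_
    filter_upwards [isOpen_ne.mem_nhds hr] with y hy using momentBump_eq hy

lemma hasCompactSupport_momentBump (i : ℕ) : HasCompactSupport (momentBump i) := by
  refine HasCompactSupport.intro (isCompact_Icc (a := (-2 : ℝ)) (b := 2)) fun r hr => ?_
  refine momentBump_eq_zero (not_lt.1 fun h => hr ?_)
  exact ⟨(abs_lt.1 h).1.le, (abs_lt.1 h).2.le⟩

lemma momentBump_neg {i : ℕ} (hi : Even i) (r : ℝ) : momentBump i (-r) = momentBump i r := by
  simp [momentBump, hi.neg_pow]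

lemma integral_pow_mul_omega_div (i : ℕ) (T : ℝ) {n : ℝ} (hn : 0 < n) :
    ∫ u in (0 : ℝ)..T, u ^ i * (1 / n * omega (u / n)) = n ^ i * omegaMoment i (T / n) := by
  have h := intervalIntegral.integral_comp_div (a := 0) (b := T) (fun t => t ^ i * omega t) hn.ne'
  rw [zero_div, smul_eq_mul] at h
  have h2 : omegaMoment i (T / n) = n⁻¹ * ∫ u in (0 : ℝ)..T, (u / n) ^ i * omega (u / n) := by
    rw [h, inv_mul_cancel_left₀ hn.ne']
    rfl
  rw [h2, ← mul_assoc, ← intervalIntegral.integral_const_mul]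
  refine intervalIntegral.integral_congr fun u _ => ?_
  simp only [div_pow]
  field_simp

/-- Scaling u = jt in the j-th term gives T^i times `momentBump i` at j/T. The truncated moment is
thus again controlled by a Riemann sum. -/
lemma integral_pow_mul_deltaKernel (i : ℕ) {T : ℝ} (hT : 0 < T) :
    ∫ u in (0 : ℝ)..T, u ^ i * deltaKernel u
      = omegaLogMass * (T ^ (i + 1) / (i + 1)) - T ^ i * ∑' j : ℕ+, momentBump i (j / T) := by
  obtain ⟨M, hM⟩ := exists_nat_ge (2 * T)
  have h1 : ∫ u in (0 : ℝ)..T, u ^ i * deltaKernel u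
      = ∫ u in (0 : ℝ)..T, (omegaLogMass * u ^ i - ∑ j ∈ Finset.range M,
          u ^ i * (1 / ((j + 1 : ℕ) : ℝ) * omega (u / (j + 1 : ℕ)))) := by
    refine intervalIntegral.integral_congr fun u hu => ?_
    rw [Set.uIcc_of_le hT.le] at hu
    rw [deltaKernel, kernelSum_eq_sum (M := M), abs_of_nonneg hu.1, mul_sub, Finset.mul_sum]
    · ring
    · rw [abs_of_nonneg hu.1]
      linarith [hu.2]
  have hc (j : ℕ) : Continuous (fun u : ℝ =>
      u ^ i * (1 / ((j + 1 : ℕ) : ℝ) * omega (u / (j + 1 : ℕ)))) := by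
    have := contDiff_omega.continuous
    fun_prop
  rw [h1, intervalIntegral.integral_sub, intervalIntegral.integral_const_mul, integral_pow,
    intervalIntegral.integral_finsetSum]
  · have h2 : ∑' j : ℕ+, momentBump i (j / T)
        = ∑ j ∈ Finset.range M, momentBump i ((j + 1 : ℕ) / T) := by
      rw [tsum_pnat_eq_tsum_succ (f := fun j : ℕ => momentBump i (j / T))]
      refine tsum_eq_sum fun j hj => momentBump_eq_zero ?_
      have hj' : (M : ℝ) ≤ j := by exact_mod_cast not_lt.1 (fun h' => hj (Finset.mem_range.2 h'))
      rw [abs_of_nonneg (by positivity), le_div_iff₀ hT]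
      push_cast
      linarith
    rw [h2, Finset.mul_sum]
    congr 1
    · simp
    refine Finset.sum_congr rfl fun j _ => ?_
    have hj : (0 : ℝ) < (j + 1 : ℕ) := by positivity
    rw [integral_pow_mul_omega_div i T hj, momentBump_eq (div_pos hj hT).ne',
      abs_of_pos (div_pos hj hT), inv_div, div_pow]
    field_simp
  · exact fun j _ => (hc j).intervalIntegrable 0 T
  · exact Continuous.intervalIntegrable (by fun_prop) 0 T
  · exact Continuous.intervalIntegrable (continuous_finsetSum _ fun j _ => hc j) 0 T

/-- A function of the form `κ T^(i+1) + o(1)` that converges has `κ = 0`. -/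
lemma eq_of_tendsto_pow_mul_add {f e : ℝ → ℝ} {κ l a : ℝ} {i : ℕ} (hf : Tendsto f atTop (𝓝 l))
    (he : Tendsto e atTop (𝓝 a)) (h : ∀ᶠ T in atTop, f T = κ * T ^ (i + 1) + e T) : l = a := by
  have h1 : Tendsto (fun T : ℝ => κ * T ^ (i + 1)) atTop (𝓝 (l - a)) :=
    (hf.sub he).congr' (h.mono fun T hT => by rw [hT]; ring)
  have h2 : Tendsto (fun T : ℝ => (T ^ (i + 1))⁻¹) atTop (𝓝 0) :=
    (tendsto_pow_atTop (Nat.succ_ne_zero i)).inv_tendsto_atTop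
  have h3 : Tendsto (fun _ : ℝ => κ) atTop (𝓝 ((l - a) * 0)) := by
    refine (h1.mul h2).congr' ?_
    filter_upwards [eventually_gt_atTop 0] with T hT
    field_simp
  have hκ : κ = 0 := by simpa using tendsto_nhds_unique tendsto_const_nhds h3
  simp only [hκ, zero_mul] at h1
  have := tendsto_nhds_unique tendsto_const_nhds h1
  linarith

/-- Poisson summation, which needs i even, shows that the moment truncated at T is a multiple of
T^{i+1}, plus `momentBump i 0 / 2 * T ^ i`, plus o(1). For i > 0 the middle term is zero. Since the
moments converge, the coefficient of T^{i+1} must vanish and need not be computed. -/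
lemma integral_Ioi_pow_mul_deltaKernel {i : ℕ} (hi : Even i) :
    ∫ u in Set.Ioi (0 : ℝ), u ^ i * deltaKernel u = momentBump i 0 / 2 * 0 ^ i := by
  obtain ⟨C, hC, h⟩ := exists_tsum_pnat_sub_integral_le (contDiff_momentBump i)
    (hasCompactSupport_momentBump i) (momentBump_neg hi) i
  have hlim := intervalIntegral_tendsto_integral_Ioi 0
    (integrable_pow_mul_deltaKernel i).integrableOn tendsto_id
  set I := ∫ x, momentBump i x
  refine eq_of_tendsto_pow_mul_add (i := i) (κ := omegaLogMass / (i + 1) - 2⁻¹ * I)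
    (e := fun T => momentBump i 0 / 2 * T ^ i - T ^ i *
      (∑' j : ℕ+, momentBump i (j / T) - (T * (2⁻¹ * I) - momentBump i 0 / 2))) hlim ?_ ?_
  · have h1 : Tendsto (fun T : ℝ => T ^ i *
      (∑' j : ℕ+, momentBump i (j / T) - (T * (2⁻¹ * I) - momentBump i 0 / 2))) atTop (𝓝 0) := by
      refine squeeze_zero_norm' (a := fun T => C * T⁻¹) ?_ ?_
      · filter_upwards [eventually_gt_atTop 0] with T hT
        rw [Real.norm_eq_abs, abs_mul, abs_of_pos (pow_pos hT i)]
        calc T ^ i * _ ≤ T ^ i * (C / T ^ (i + 1)) := by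
              gcongr
              exact h T hT
          _ = C * T⁻¹ := by
              rw [pow_succ]
              field_simp
      · simpa using tendsto_inv_atTop_zero.const_mul C
    have h2 : Tendsto (fun T : ℝ => momentBump i 0 / 2 * T ^ i) atTop
        (𝓝 (momentBump i 0 / 2 * 0 ^ i)) := by
      rcases Nat.eq_zero_or_pos i with rfl | hi0
      · simp
      · have : momentBump i 0 = 0 := by simp [momentBump, hi0.ne']
        simp [this]
    simpa using h2.sub h1
  · filter_upwards [eventually_gt_atTop 0] with T hT
    simp only [id]
    rw [integral_pow_mul_deltaKernel i hT]
    ring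

/-- The kernel is even: odd moments vanish by symmetry and even ones are twice the half-line moment.
For i = 0 this is the normalisation ∫ ω = 1. -/
lemma integral_univ_pow_mul_deltaKernel (i : ℕ) :
    ∫ u, u ^ i * deltaKernel u = if i = 0 then 1 else 0 := by
  rcases Nat.even_or_odd i with hi | hi
  · have h1 := integral_comp_abs (f := fun u => u ^ i * deltaKernel u)
    simp only [hi.pow_abs, deltaKernel_abs] at h1
    rw [h1, integral_Ioi_pow_mul_deltaKernel hi]
    split_ifs with h0
    · subst h0
      simp [momentBump, omegaMoment_zero_one]
    · simp [h0]
  · have h1 := integral_neg_eq_self (fun u => u ^ i * deltaKernel u) volume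
    simp only [hi.neg_pow, deltaKernel_neg, neg_mul, integral_neg] at h1
    rw [if_neg (by rintro rfl; simp at hi)]
    linarith

/-- Taylor's formula at any point of the line, with a uniform bound of the remainder. -/
lemma exists_taylor_bound {n : ℕ} {g : ℝ → ℝ} (hg : ContDiff ℝ (n + 1 : ℕ) g) {M : ℝ}
    (hM : ∀ s, |iteratedDeriv (n + 1) g s| ≤ M) (ξ : ℝ) :
    ∃ a : ℕ → ℝ, a 0 = g ξ ∧ ∀ s, |g (ξ + s) - ∑ i ∈ Finset.range (n + 1), a i * s ^ i|
      ≤ M * |s| ^ (n + 1) := by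
  refine ⟨fun i => ((i.factorial : ℝ))⁻¹ * iteratedDeriv i g ξ, by simp, fun s => ?_⟩
  have hM0 : 0 ≤ M := (abs_nonneg _).trans (hM 0)
  rcases eq_or_ne s 0 with rfl | hs
  · rw [Finset.sum_range_succ']
    simp
  have hne : ξ ≠ ξ + s := by simpa using hs
  obtain ⟨y, hy, h⟩ := taylor_mean_remainder_lagrange_iteratedDeriv (n := n) hne
    (hg.contDiffOn.of_le (by simp))
  have ht : taylorWithinEval g n (Set.uIcc ξ (ξ + s)) ξ (ξ + s)
      = ∑ i ∈ Finset.range (n + 1), ((i.factorial : ℝ))⁻¹ * iteratedDeriv i g ξ * s ^ i := by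
    rw [taylor_within_apply]
    refine Finset.sum_congr rfl fun i hi => ?_
    rw [iteratedDerivWithin_eq_iteratedDeriv (uniqueDiffOn_uIcc hne) _ Set.left_mem_uIcc,
      add_sub_cancel_left, smul_eq_mul]
    · ring
    · refine hg.contDiffAt.of_le ?_
      exact_mod_cast (Finset.mem_range.1 hi).le
  rw [ht, add_sub_cancel_left] at h
  rw [h, abs_div, abs_mul, abs_pow, Nat.abs_cast]
  refine (div_le_self (by positivity) (by exact_mod_cast Nat.factorial_pos _)).trans ?_
  gcongr
  exact hM y

/-- The kernel reproduces the value at the centre up to a power of the scale as high as the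
smoothness of the function permits. -/
lemma exists_integral_deltaKernel_sub_le (n : ℕ) :
    ∃ C : ℝ, 0 ≤ C ∧ ∀ g : ℝ → ℝ, ContDiff ℝ (n + 1 : ℕ) g → ∀ M : ℝ,
      (∀ s, |iteratedDeriv (n + 1) g s| ≤ M) → ∀ ξ l : ℝ,
      |(∫ u, g (ξ + l * u) * deltaKernel u) - g ξ| ≤ C * |l| ^ (n + 1) * M := by
  refine ⟨∫ u, |u ^ (n + 1) * deltaKernel u|, integral_nonneg fun _ => abs_nonneg _, ?_⟩
  intro g hg M hM ξ l
  obtain ⟨a, ha0, ha⟩ := exists_taylor_bound hg hM ξ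
  have hM0 : 0 ≤ M := (abs_nonneg _).trans (hM 0)
  -- Against the kernel the Taylor polynomial integrates to its constant term g(ξ), so only the
  -- Taylor remainder contributes to the error.
  set P : ℝ → ℝ := fun u => ∑ i ∈ Finset.range (n + 1), a i * (l * u) ^ i with hP
  have hterm (i : ℕ) : Integrable (fun u => a i * l ^ i * (u ^ i * deltaKernel u)) :=
    (integrable_pow_mul_deltaKernel i).const_mul _
  have hPeq : (fun u => P u * deltaKernel u)
      = fun u => ∑ i ∈ Finset.range (n + 1), a i * l ^ i * (u ^ i * deltaKernel u) := by
    ext u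
    rw [hP, Finset.sum_mul]
    refine Finset.sum_congr rfl fun i _ => ?_
    rw [mul_pow]
    ring
  have hPint : Integrable (fun u => P u * deltaKernel u) := by
    rw [hPeq]
    exact integrable_finsetSum _ fun i _ => hterm i
  have hPval : ∫ u, P u * deltaKernel u = g ξ := by
    rw [hPeq, integral_finsetSum _ fun i _ => hterm i, Finset.sum_eq_single 0]
    · rw [integral_const_mul, integral_univ_pow_mul_deltaKernel]
      simp [ha0]
    · intro i _ hi
      rw [integral_const_mul, integral_univ_pow_mul_deltaKernel, if_neg hi, mul_zero]
    · simp
  have hbd (u : ℝ) : |(g (ξ + l * u) - P u) * deltaKernel u|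
      ≤ |l| ^ (n + 1) * M * |u ^ (n + 1) * deltaKernel u| := by
    rw [abs_mul, abs_mul, abs_pow]
    have := ha (l * u)
    rw [abs_mul, mul_pow] at this
    calc _ ≤ M * (|l| ^ (n + 1) * |u| ^ (n + 1)) * |deltaKernel u| := by gcongr
      _ = _ := by ring
  have hint := (integrable_pow_mul_deltaKernel (n + 1)).abs.const_mul (|l| ^ (n + 1) * M)
  have hdiff : Integrable (fun u => (g (ξ + l * u) - P u) * deltaKernel u) := by
    refine hint.mono' ?_ (Eventually.of_forall hbd)
    have h1 := continuous_deltaKernel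
    have h2 := hg.continuous
    exact Continuous.aestronglyMeasurable (by fun_prop)
  have hsplit : ∫ u, g (ξ + l * u) * deltaKernel u
      = (∫ u, (g (ξ + l * u) - P u) * deltaKernel u) + g ξ := by
    rw [← hPval, ← integral_add hdiff hPint]
    refine integral_congr_ae (Eventually.of_forall fun u => ?_)
    simp only
    ring
  rw [hsplit, add_sub_cancel_right]
  refine (norm_integral_le_of_norm_le (f := fun u => (g (ξ + l * u) - P u) * deltaKernel u) hint
    (Eventually.of_forall hbd)).trans_eq ?_
  rw [integral_const_mul]
  ring

end

/-! ### The area formula for graphs of C¹ functions, with Hausdorff measure. -/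

section

section GraphArea

open scoped NNReal ENNReal Topology
open Filter Module

/-- Images under two maps that are Lipschitz with respect to each other. -/
lemma euclideanHausdorffMeasure_image_le_of_dist_le {X : Type*} {n : ℕ}
    {W : Type*} [NormedAddCommGroup W] [MeasurableSpace W] [BorelSpace W] {s : Set X} {f g : X → W}
    {K : ℝ≥0} (h : ∀ x ∈ s, ∀ y ∈ s, ‖f x - f y‖ ≤ K * ‖g x - g y‖) :
    μHE[n] (f '' s) ≤ (K : ℝ≥0∞) ^ n * μHE[n] (g '' s) := by
  classical
  rcases s.eq_empty_or_nonempty with rfl | ⟨x0, hx0⟩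
  · simp
  have : Nonempty X := ⟨x0⟩
  -- This is f composed with an inverse of g; the choice of preimage is immaterial, because the
  -- hypothesis forces f x = f y when g x = g y.
  let φ : W → W := fun w => f (Function.invFunOn g s w)
  have hφ (x : X) (hx : x ∈ s) : φ (g x) = f x := by
    have h1 : Function.invFunOn g s (g x) ∈ s := Function.invFunOn_mem ⟨x, hx, rfl⟩
    have h2 : g (Function.invFunOn g s (g x)) = g x := Function.invFunOn_eq ⟨x, hx, rfl⟩
    have h3 := h _ h1 x hx
    rw [h2, sub_self, norm_zero, mul_zero] at h3
    exact sub_eq_zero.1 (norm_le_zero_iff.1 h3)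
  have hL : LipschitzOnWith K φ (g '' s) := by
    refine LipschitzOnWith.of_dist_le_mul ?_
    rintro _ ⟨x, hx, rfl⟩ _ ⟨y, hy, rfl⟩
    rw [hφ x hx, hφ y hy, dist_eq_norm, dist_eq_norm]
    exact h x hx y hy
  have himg : f '' s = φ '' (g '' s) := by
    rw [Set.image_image]
    exact Set.image_congr fun x hx => (hφ x hx).symm
  have h1 := hL.hausdorffMeasure_image_le (d := n) n.cast_nonneg
  rw [← himg, ENNReal.rpow_natCast] at h1
  simp only [Measure.euclideanHausdorffMeasure_def, Measure.smul_apply, ENNReal.smul_def, smul_eq_mul]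
  rw [mul_left_comm]
  gcongr

variable {V W : Type*} [NormedAddCommGroup V] [InnerProductSpace ℝ V] [FiniteDimensional ℝ V]
  [NormedAddCommGroup W] [InnerProductSpace ℝ W] [FiniteDimensional ℝ W]

/-- The graph of `g` over `V`, embedded in `W` by an isometry `ι` and a normal vector `e`. -/
def graphMap (ι : V →ₗᵢ[ℝ] W) (e : W) (g : V → ℝ) (v : V) : W := ι v + g v • e

/-- The area element `√(1 + |a|²)` of a graph with gradient `a`. -/
def graphJac (a : V →L[ℝ] ℝ) : ℝ := Real.sqrt (1 + ‖a‖ ^ 2)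

omit [FiniteDimensional ℝ V] in
lemma one_le_graphJac (a : V →L[ℝ] ℝ) : 1 ≤ graphJac a := by
  rw [graphJac, Real.one_le_sqrt]
  nlinarith [norm_nonneg a]

omit [FiniteDimensional ℝ V] in
-- The multiplicative form is chosen so that errors on countably many pieces can be summed.
lemma graphJac_le {a b : V →L[ℝ] ℝ} {δ : ℝ} (h : ‖a - b‖ ≤ δ) :
    graphJac a ≤ (1 + δ) * graphJac b := by
  have hδ : 0 ≤ δ := (norm_nonneg _).trans h
  have h1 : ‖a‖ ≤ ‖b‖ + δ := by
    have := norm_add_le b (a - b)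
    rw [add_sub_cancel] at this
    linarith
  have hb := norm_nonneg b
  have hJ := one_le_graphJac b
  have hJ2 : graphJac b ^ 2 = 1 + ‖b‖ ^ 2 := Real.sq_sqrt (by positivity)
  have hbJ : ‖b‖ ≤ graphJac b := Real.le_sqrt_of_sq_le (by linarith)
  rw [graphJac]
  refine Real.sqrt_le_iff.2 ⟨by positivity, ?_⟩
  have h2 : ‖a‖ ^ 2 ≤ (‖b‖ + δ) ^ 2 := by gcongr
  nlinarith [mul_nonneg hδ hb, mul_nonneg hδ (sub_nonneg.2 hbJ), mul_nonneg (mul_nonneg hδ hδ) (sub_nonneg.2 hJ),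
    mul_nonneg hδ (sub_nonneg.2 hJ), mul_nonneg (sub_nonneg.2 hbJ) (sub_nonneg.2 hJ)]

variable (ι : V →ₗᵢ[ℝ] W) {e : W} (he : ‖e‖ = 1) (hι : ∀ v, inner ℝ (ι v) e = 0)

include he hι in
-- If b represents a, then A*A = 1 + b ⊗ b, a transvection with determinant 1 + |b|².
lemma normDet_graph (a : V →L[ℝ] ℝ) :
    (ι.toLinearMap + (a : V →ₗ[ℝ] ℝ).smulRight e).normDet = graphJac a := by
  set A : V →ₗ[ℝ] W := ι.toLinearMap + (a : V →ₗ[ℝ] ℝ).smulRight e with hA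
  let b : V := (InnerProductSpace.toDual ℝ V).symm a
  have hb (v : V) : inner ℝ b v = a v := InnerProductSpace.toDual_symm_apply
  have h1 : A.adjoint ∘ₗ A = LinearMap.transvection (a : V →ₗ[ℝ] ℝ) b := by
    ext v
    refine ext_inner_right ℝ fun w => ?_
    rw [LinearMap.comp_apply, LinearMap.adjoint_inner_left]
    have h2 : inner ℝ e (ι w) = 0 := by rw [real_inner_comm, hι]
    simp [hA, LinearMap.transvection.apply, inner_add_left, inner_add_right, inner_smul_left,
      inner_smul_right, hι, h2, he, hb]
    ring
  have h2 := A.normDet_sq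
  rw [h1, LinearMap.transvection.det] at h2
  have h3 : a b = ‖a‖ ^ 2 := by
    rw [← hb b, real_inner_self_eq_norm_sq, LinearIsometryEquiv.norm_map]
  rw [graphJac, ← h3, eq_comm, Real.sqrt_eq_iff_eq_sq _ A.normDet_nonneg]
  · exact h2.symm
  · rw [h3]
    positivity

omit [FiniteDimensional ℝ V] [FiniteDimensional ℝ W] in
include hι in
lemma norm_le_norm_add_smul (v : V) (t : ℝ) : ‖v‖ ≤ ‖ι v + t • e‖ := by
  have h : ‖ι v + t • e‖ * ‖ι v + t • e‖ = ‖ι v‖ * ‖ι v‖ + ‖t • e‖ * ‖t • e‖ :=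
    norm_add_sq_eq_norm_sq_add_norm_sq_real (by rw [inner_smul_right, hι, mul_zero])
  rw [ι.norm_map] at h
  nlinarith [norm_nonneg v, norm_nonneg (ι v + t • e), mul_self_nonneg ‖t • e‖]

omit [FiniteDimensional ℝ V] [FiniteDimensional ℝ W] in
include hι in
lemma graphMap_injective (g : V → ℝ) : Function.Injective (graphMap ι e g) := by
  intro x y h
  have h1 := norm_le_norm_add_smul ι hι (x - y) (g x - g y)
  have h2 : ι (x - y) + (g x - g y) • e = graphMap ι e g x - graphMap ι e g y := by
    simp only [graphMap, map_sub, sub_smul]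
    abel
  rw [h2, h, sub_self, norm_zero] at h1
  exact sub_eq_zero.1 (norm_le_zero_iff.1 h1)

variable [MeasurableSpace V] [BorelSpace V] [MeasurableSpace W] [BorelSpace W]

include he hι in
/-- Two-sided comparison of the area of a nearly flat piece of a graph with that of a plane. -/
lemma graph_area_le {g : V → ℝ} {a : V →L[ℝ] ℝ} {δ : ℝ≥0} {s : Set V}
    (h : ∀ x ∈ s, ∀ y ∈ s, |g x - g y - a (x - y)| ≤ δ * ‖x - y‖) :
    μHE[finrank ℝ V] (graphMap ι e g '' s)
      ≤ ((1 + δ : ℝ≥0) : ℝ≥0∞) ^ finrank ℝ V * (ENNReal.ofReal (graphJac a) * volume s) ∧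
    ENNReal.ofReal (graphJac a) * volume s
      ≤ ((1 + δ : ℝ≥0) : ℝ≥0∞) ^ finrank ℝ V * μHE[finrank ℝ V] (graphMap ι e g '' s) := by
  set A : V →ₗ[ℝ] W := ι.toLinearMap + (a : V →ₗ[ℝ] ℝ).smulRight e with hA
  have hvol : ENNReal.ofReal (graphJac a) * volume s = μHE[finrank ℝ V] (A '' s) := by
    rw [A.euclideanHausdorffMeasure_image_eq_normDet_mul_volume, normDet_graph ι he hι]
  have hAx (x y : V) : A x - A y = ι (x - y) + a (x - y) • e := by
    rw [← map_sub]
    rfl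
  have hGx (x y : V) : graphMap ι e g x - graphMap ι e g y = ι (x - y) + (g x - g y) • e := by
    simp only [graphMap, map_sub, sub_smul]
    abel
  have hd (x y : V) : (graphMap ι e g x - graphMap ι e g y) - (A x - A y)
      = (g x - g y - a (x - y)) • e := by
    rw [hAx, hGx, sub_smul (g x - g y)]
    abel
  have hdn (x : V) (hx : x ∈ s) (y : V) (hy : y ∈ s) :
      ‖(graphMap ι e g x - graphMap ι e g y) - (A x - A y)‖ ≤ δ * ‖x - y‖ := by
    rw [hd, norm_smul, he, mul_one]
    exact h x hx y hy
  rw [hvol]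
  constructor
  · refine euclideanHausdorffMeasure_image_le_of_dist_le fun x hx y hy => ?_
    have h1 := hdn x hx y hy
    have h2 := norm_le_norm_add_smul ι hι (x - y) (a (x - y))
    rw [← hAx] at h2
    have h3 := norm_add_le (A x - A y) ((graphMap ι e g x - graphMap ι e g y) - (A x - A y))
    rw [add_sub_cancel] at h3
    push_cast
    nlinarith [mul_le_mul_of_nonneg_left h2 δ.2]
  · refine euclideanHausdorffMeasure_image_le_of_dist_le fun x hx y hy => ?_
    have h1 := hdn x hx y hy
    have h2 := norm_le_norm_add_smul ι hι (x - y) (g x - g y)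
    rw [← hGx] at h2
    have h3 := norm_sub_le (graphMap ι e g x - graphMap ι e g y)
      ((graphMap ι e g x - graphMap ι e g y) - (A x - A y))
    rw [sub_sub_cancel] at h3
    push_cast
    nlinarith [mul_le_mul_of_nonneg_left h2 δ.2]

include he hι in
-- The additional factor 1 + δ, whence the exponent dim V + 1, pays for replacing the area element
-- of the comparison plane by the varying one.
lemma graph_area_le_lintegral {g : V → ℝ} {g' : V → V →L[ℝ] ℝ} {a : V →L[ℝ] ℝ} {δ : ℝ≥0}
    {s : Set V} (hs : MeasurableSet s)
    (h : ∀ x ∈ s, ∀ y ∈ s, |g x - g y - a (x - y)| ≤ δ * ‖x - y‖)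
    (h' : ∀ x ∈ s, ‖g' x - a‖ ≤ δ) :
    μHE[finrank ℝ V] (graphMap ι e g '' s) ≤ ((1 + δ : ℝ≥0) : ℝ≥0∞) ^ (finrank ℝ V + 1)
      * ∫⁻ x in s, ENNReal.ofReal (graphJac (g' x)) ∧
    ∫⁻ x in s, ENNReal.ofReal (graphJac (g' x)) ≤ ((1 + δ : ℝ≥0) : ℝ≥0∞) ^ (finrank ℝ V + 1)
      * μHE[finrank ℝ V] (graphMap ι e g '' s) := by
  obtain ⟨h1, h2⟩ := graph_area_le ι he hι h
  have hconst : ENNReal.ofReal (graphJac a) * volume s = ∫⁻ _ in s, ENNReal.ofReal (graphJac a) := by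
    rw [setLIntegral_const]
  have hmul (b c : V →L[ℝ] ℝ) (hbc : ‖b - c‖ ≤ δ) : ENNReal.ofReal (graphJac b)
      ≤ ((1 + δ : ℝ≥0) : ℝ≥0∞) * ENNReal.ofReal (graphJac c) := by
    rw [← ENNReal.ofReal_coe_nnreal, ← ENNReal.ofReal_mul (NNReal.coe_nonneg _)]
    refine ENNReal.ofReal_le_ofReal ?_
    push_cast
    exact graphJac_le hbc
  constructor
  · rw [pow_succ, mul_assoc]
    refine h1.trans (mul_le_mul_right ?_ _)
    rw [hconst, ← lintegral_const_mul' _ _ ENNReal.coe_ne_top]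
    refine setLIntegral_mono' hs fun x hx => hmul _ _ ?_
    rw [norm_sub_rev]
    exact h' x hx
  · rw [pow_succ', mul_assoc]
    refine le_trans ?_ (mul_le_mul_right h2 _)
    rw [hconst, ← lintegral_const_mul' _ _ ENNReal.coe_ne_top]
    exact setLIntegral_mono' hs fun x hx => hmul _ _ (h' x hx)

include he hι in
/-- The area formula for the graph of a `C¹` function. -/
theorem graph_area {g : V → ℝ} {g' : V → V →L[ℝ] ℝ} {U : Set V} (hU : IsOpen U)
    (hg : ∀ x ∈ U, HasFDerivAt g (g' x) x) (hg' : ContinuousOn g' U) {s : Set V}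
    (hs : MeasurableSet s) (hsU : s ⊆ U) :
    μHE[finrank ℝ V] (graphMap ι e g '' s) = ∫⁻ x in s, ENNReal.ofReal (graphJac (g' x)) := by
  rcases s.eq_empty_or_nonempty with rfl | hne
  · simp
  -- Countably many balls on which g' varies by at most δ cover s. Disjoint pieces of s inside them
  -- are compared with planes, the comparisons are added, and finally δ → 0.
  have key (δ : ℝ≥0) (hδ : 0 < δ) :
      μHE[finrank ℝ V] (graphMap ι e g '' s) ≤ ((1 + δ : ℝ≥0) : ℝ≥0∞) ^ (finrank ℝ V + 1)
        * ∫⁻ x in s, ENNReal.ofReal (graphJac (g' x)) ∧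
      ∫⁻ x in s, ENNReal.ofReal (graphJac (g' x)) ≤ ((1 + δ : ℝ≥0) : ℝ≥0∞) ^ (finrank ℝ V + 1)
        * μHE[finrank ℝ V] (graphMap ι e g '' s) := by
    have hball (x : V) : ∃ r : ℝ, x ∈ s → 0 < r ∧ Metric.ball x r ⊆ U ∧
        ∀ y ∈ Metric.ball x r, ‖g' y - g' x‖ ≤ δ := by
      by_cases hx : x ∈ s
      · have h1 : ∀ᶠ y in 𝓝 x, ‖g' y - g' x‖ < δ := by
          have h2 := (hg'.continuousAt (hU.mem_nhds (hsU hx))).sub (continuousAt_const (y := g' x))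
          have h3 := h2.norm
          simp only [ContinuousAt, Pi.sub_apply, sub_self, norm_zero] at h3
          exact h3.eventually (gt_mem_nhds (by exact_mod_cast hδ))
        obtain ⟨r, hr, hr'⟩ := Metric.mem_nhds_iff.1 (h1.and (hU.mem_nhds (hsU hx)))
        exact ⟨r, fun _ => ⟨hr, fun y hy => (hr' hy).2, fun y hy => (hr' hy).1.le⟩⟩
      · exact ⟨0, fun h => absurd h hx⟩
    choose r hr using hball
    obtain ⟨t, hts, htc, hcov⟩ := TopologicalSpace.countable_cover_nhdsWithin (s := s)
      (f := fun x => Metric.ball x (r x))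
      (fun x hx => mem_nhdsWithin_of_mem_nhds (Metric.ball_mem_nhds x (hr x hx).1))
    have htne : t.Nonempty := by
      by_contra h0
      rw [Set.not_nonempty_iff_eq_empty.1 h0] at hcov
      obtain ⟨x, hx⟩ := hne
      simpa using hcov hx
    obtain ⟨c, hc⟩ := htc.exists_eq_range htne
    have hcs (n : ℕ) : c n ∈ s := hts (hc ▸ Set.mem_range_self n)
    let B : ℕ → Set V := fun n => Metric.ball (c n) (r (c n))
    let P : ℕ → Set V := fun n => s ∩ disjointed B n
    have hPm (n : ℕ) : MeasurableSet (P n) :=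
      hs.inter (MeasurableSet.disjointed (fun i => Metric.isOpen_ball.measurableSet) n)
    have hPd : Pairwise (Function.onFun Disjoint P) := fun i j hij =>
      (disjoint_disjointed B hij).mono Set.inter_subset_right Set.inter_subset_right
    have hPB (n : ℕ) : P n ⊆ B n := fun x hx => disjointed_subset B n hx.2
    have hPU : ⋃ n, P n = s := by
      rw [← Set.inter_iUnion, iUnion_disjointed, Set.inter_eq_left]
      refine hcov.trans ?_
      rw [hc]
      simp [B]
    have hpiece (n : ℕ) := graph_area_le_lintegral ι he hι (g := g) (g' := g') (a := g' (c n))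
      (δ := δ) (hPm n) (fun x hx y hy => by
        have hcn := hr _ (hcs n)
        -- Mean value inequality for g minus its linearisation at the centre of the ball.
        have := (convex_ball (c n) (r (c n))).norm_image_sub_le_of_norm_hasFDerivWithin_le
          (f := fun z => g z - g' (c n) z) (f' := fun z => g' z - g' (c n)) (𝕜 := ℝ) (C := δ)
          (fun z hz => ((hg z (hcn.2.1 hz)).sub (g' (c n)).hasFDerivAt).hasFDerivWithinAt)
          (fun z hz => hcn.2.2 z hz) (hPB n hy) (hPB n hx)
        rw [Real.norm_eq_abs] at this
        convert this using 2
        rw [map_sub]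
        ring) (fun x hx => (hr _ (hcs n)).2.2 x (hPB n hx))
    have hinj := graphMap_injective ι hι g
    have hgc : ContinuousOn (graphMap ι e g) U := by
      have h1 : ContinuousOn g U := fun x hx => (hg x hx).continuousAt.continuousWithinAt
      exact ι.continuous.continuousOn.add (h1.smul continuousOn_const)
    have himg (n : ℕ) : MeasurableSet (graphMap ι e g '' P n) :=
      (hPm n).image_of_continuousOn_injOn
        (hgc.mono (Set.inter_subset_left.trans hsU)) hinj.injOn
    have hμ : μHE[finrank ℝ V] (graphMap ι e g '' s)
        = ∑' n, μHE[finrank ℝ V] (graphMap ι e g '' P n) := by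
      rw [← measure_iUnion _ himg, ← Set.image_iUnion, hPU]
      exact fun i j hij => (Set.disjoint_image_iff hinj).2 (hPd hij)
    have hI : ∫⁻ x in s, ENNReal.ofReal (graphJac (g' x))
        = ∑' n, ∫⁻ x in P n, ENNReal.ofReal (graphJac (g' x)) := by
      rw [← lintegral_iUnion hPm hPd, hPU]
    rw [hμ, hI, ← ENNReal.tsum_mul_left, ← ENNReal.tsum_mul_left]
    exact ⟨ENNReal.tsum_le_tsum fun n => (hpiece n).1, ENNReal.tsum_le_tsum fun n => (hpiece n).2⟩
  have hlim (X : ℝ≥0∞) : Tendsto (fun δ : ℝ≥0 => ((1 + δ : ℝ≥0) : ℝ≥0∞) ^ (finrank ℝ V + 1) * X)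
      (𝓝[>] 0) (𝓝 X) := by
    have h1 : Tendsto (fun δ : ℝ≥0 => (((1 + δ) ^ (finrank ℝ V + 1) : ℝ≥0) : ℝ≥0∞))
        (𝓝[>] 0) (𝓝 ((1 : ℝ≥0) : ℝ≥0∞)) := by
      refine ENNReal.tendsto_coe.2 ?_
      have h2 : Continuous (fun δ : ℝ≥0 => (1 + δ) ^ (finrank ℝ V + 1)) := by fun_prop
      have h3 := h2.tendsto 0
      simp only [add_zero, one_pow] at h3
      exact h3.mono_left nhdsWithin_le_nhds
    have h4 := ENNReal.Tendsto.mul_const (b := X) h1 (Or.inl (by simp))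
    simpa using h4
  refine le_antisymm ?_ ?_
  · refine ge_of_tendsto (hlim _) ?_
    filter_upwards [self_mem_nhdsWithin] with δ hδ using (key δ hδ).1
  · refine ge_of_tendsto (hlim _) ?_
    filter_upwards [self_mem_nhdsWithin] with δ hδ using (key δ hδ).2

include he hι in
/-- Hausdorff measure on the graph of a `C¹` function, as the image of a density on the base. -/
theorem restrict_graph_eq_map {g : V → ℝ} {g' : V → V →L[ℝ] ℝ} {U : Set V} (hU : IsOpen U)
    (hg : ∀ x ∈ U, HasFDerivAt g (g' x) x) (hg' : ContinuousOn g' U) (hgm : Measurable g)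
    {s : Set V} (hs : MeasurableSet s) (hsU : s ⊆ U) :
    (μHE[finrank ℝ V] : Measure W).restrict (graphMap ι e g '' s)
      = ((volume.restrict s).withDensity fun x => ENNReal.ofReal (graphJac (g' x))).map
        (graphMap ι e g) := by
  have hm : Measurable (graphMap ι e g) :=
    ι.continuous.measurable.add (hgm.smul_const e)
  ext A hA
  rw [Measure.restrict_apply hA, Measure.map_apply hm hA, withDensity_apply _ (hm hA),
    Measure.restrict_restrict (hm hA), Set.inter_comm A, ← Set.image_inter_preimage, Set.inter_comm s,
    graph_area ι he hι hU hg hg' ((hm hA).inter hs) (Set.inter_subset_right.trans hsU)]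

end GraphArea

end

/-! ### The quadric as a union of graphs over coordinate hyperplanes. -/

section

open scoped NNReal ENNReal Topology
open Filter Module

/-- The coordinate hyperplane `ℝ^(d-1)` of all coordinates other than `x_i`. -/
abbrev Slice (k : ℕ) (i : Fin k) : Type := EuclideanSpace ℝ {s : Fin k ⊕ Fin k // s ≠ Sum.inl i}

variable {k : ℕ}

lemma sum_dite_ne {ι : Type*} [Fintype ι] [DecidableEq ι] (a : ι) (F : {s // s ≠ a} → ℝ) :
    ∑ s, (if h : s ≠ a then F ⟨s, h⟩ else 0) = ∑ s, F s := by
  rw [← Fintype.sum_subtype_add_sum_subtype (fun s => s ≠ a)]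
  have h1 : ∑ s : {s // ¬ s ≠ a}, (if h : (s : ι) ≠ a then F ⟨s, h⟩ else 0) = 0 :=
    Finset.sum_eq_zero fun s _ => dif_neg s.2
  rw [h1, add_zero]
  exact Finset.sum_congr rfl fun s _ => dif_pos s.2

/-- The inclusion of the coordinate hyperplane. -/
def sliceIncl (i : Fin k) : Slice k i →ₗᵢ[ℝ] Space k where
  toFun v := WithLp.toLp 2 (fun s => if h : s ≠ Sum.inl i then v ⟨s, h⟩ else 0)
  map_add' v w := by
    ext s
    by_cases h : s = Sum.inl i <;> simp [h]
  map_smul' c v := by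
    ext s
    by_cases h : s = Sum.inl i <;> simp [h]
  norm_map' v := by
    rw [EuclideanSpace.norm_eq, EuclideanSpace.norm_eq, ← sum_dite_ne]
    congr 1
    refine Finset.sum_congr rfl fun s _ => ?_
    by_cases h : s = Sum.inl i <;> simp [h]

/-- The projection to the coordinate hyperplane. -/
def sliceProj (i : Fin k) : Space k →ₗ[ℝ] Slice k i where
  toFun z := WithLp.toLp 2 (fun s => z s)
  map_add' _ _ := rfl
  map_smul' _ _ := rfl

lemma sliceIncl_apply_ne (i : Fin k) (v : Slice k i) {s : Fin k ⊕ Fin k} (h : s ≠ Sum.inl i) :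
    sliceIncl i v s = v ⟨s, h⟩ := dif_pos h

lemma sliceIncl_apply_self (i : Fin k) (v : Slice k i) : sliceIncl i v (Sum.inl i) = 0 :=
  dif_neg (not_not.2 rfl)

lemma inner_sliceIncl (i : Fin k) (z : Space k) (v : Slice k i) :
    inner ℝ z (sliceIncl i v) = inner ℝ (sliceProj i z) v := by
  rw [PiLp.inner_apply, PiLp.inner_apply, ← sum_dite_ne]
  refine Finset.sum_congr rfl fun s _ => ?_
  by_cases h : s = Sum.inl i
  · subst h
    simp [sliceIncl_apply_self]
  · simp [sliceIncl_apply_ne i v h, h, sliceProj]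
    exact Or.inl rfl

lemma norm_sq_sliceProj (i : Fin k) (z : Space k) :
    ‖z‖ ^ 2 = ‖sliceProj i z‖ ^ 2 + z (Sum.inl i) ^ 2 := by
  rw [EuclideanSpace.norm_sq_eq, EuclideanSpace.norm_sq_eq, ← sum_dite_ne,
    ← Finset.add_sum_erase _ _ (Finset.mem_univ (Sum.inl i)),
    ← Finset.add_sum_erase Finset.univ (fun s => dite _ _ _) (Finset.mem_univ (Sum.inl i))]
  rw [dif_neg (not_not.2 rfl), zero_add, add_comm, Real.norm_eq_abs, sq_abs]
  congr 1
  refine Finset.sum_congr rfl fun s hs => ?_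
  rw [dif_pos (Finset.ne_of_mem_erase hs)]
  rfl

/-- The unit vector of the coordinate `x_i`. -/
def sliceNormal (i : Fin k) : Space k := EuclideanSpace.single (Sum.inl i) 1

lemma norm_sliceNormal (i : Fin k) : ‖sliceNormal i‖ = 1 := by simp [sliceNormal]

lemma inner_sliceIncl_sliceNormal (i : Fin k) (v : Slice k i) :
    inner ℝ (sliceIncl i v) (sliceNormal i) = 0 := by
  simp [sliceNormal, EuclideanSpace.inner_single_right, sliceIncl_apply_self]

/-- The point with coordinate `x_i = ξ` and other coordinates `v`. -/
def sliceIns (i : Fin k) (ξ : ℝ) (v : Slice k i) : Space k := sliceIncl i v + ξ • sliceNormal i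

lemma sliceIns_apply_ne (i : Fin k) (ξ : ℝ) (v : Slice k i) {s : Fin k ⊕ Fin k}
    (h : s ≠ Sum.inl i) : sliceIns i ξ v s = v ⟨s, h⟩ := by
  simp [sliceIns, sliceNormal, sliceIncl_apply_ne i v h, h]

lemma sliceIns_apply_self (i : Fin k) (ξ : ℝ) (v : Slice k i) :
    sliceIns i ξ v (Sum.inl i) = ξ := by
  simp [sliceIns, sliceNormal, sliceIncl_apply_self]

lemma sliceIns_apply_inr (i : Fin k) (ξ : ℝ) (v : Slice k i) (l : Fin k) :
    sliceIns i ξ v (Sum.inr l) = v ⟨Sum.inr l, by simp⟩ := sliceIns_apply_ne i ξ v _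

/-- The coordinate `y_i` on the hyperplane of the coordinates other than `x_i`. -/
def sliceY (i : Fin k) (v : Slice k i) : ℝ := v ⟨Sum.inr i, by simp⟩

/-- The value of the quadratic form at `x_i = 0`. -/
def sliceF (i : Fin k) (v : Slice k i) : ℝ := F0 (sliceIncl i v)

lemma sum_F0_ne (i : Fin k) (z : Space k) : F0 z = z (Sum.inl i) * z (Sum.inr i)
    + ∑ l ∈ Finset.univ.erase i, z (Sum.inl l) * z (Sum.inr l) := by
  rw [F0, Finset.add_sum_erase _ (fun l => z (Sum.inl l) * z (Sum.inr l)) (Finset.mem_univ i)]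

lemma F0_sliceIns (i : Fin k) (ξ : ℝ) (v : Slice k i) :
    F0 (sliceIns i ξ v) = ξ * sliceY i v + sliceF i v := by
  have h0 : sliceIncl i v = sliceIns i 0 v := by simp [sliceIns]
  rw [sliceF, h0, sum_F0_ne i, sum_F0_ne i (sliceIns i 0 v), sliceIns_apply_self,
    sliceIns_apply_self, zero_mul, zero_add, sliceIns_apply_inr]
  congr 1
  refine Finset.sum_congr rfl fun l hl => ?_
  have hl' : Sum.inl l ≠ (Sum.inl i : Fin k ⊕ Fin k) := by simpa using Finset.ne_of_mem_erase hl
  rw [sliceIns_apply_ne i _ v hl', sliceIns_apply_ne i _ v hl', sliceIns_apply_inr, sliceIns_apply_inr]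

/-- The quadric `Σ_t` as a graph over the hyperplane of the coordinates other than `x_i`. -/
def sliceG (i : Fin k) (t : ℝ) (v : Slice k i) : ℝ := (t - sliceF i v) / sliceY i v

/-- The region of `ℝ^d` on which `y_i` is the first of the largest coordinates of `y ≠ 0`. -/
def sector (i : Fin k) : Set (Space k) :=
  {z | z (Sum.inr i) ≠ 0 ∧ ∀ l, |z (Sum.inr l)| ≤ |z (Sum.inr i)| ∧
    (l < i → |z (Sum.inr l)| < |z (Sum.inr i)|)}

/-- The same region in the hyperplane of the coordinates other than `x_i`. -/
def sliceSector (i : Fin k) : Set (Slice k i) := sliceIncl i ⁻¹' sector i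

lemma sliceIns_mem_sector {i : Fin k} {ξ : ℝ} {v : Slice k i} :
    sliceIns i ξ v ∈ sector i ↔ v ∈ sliceSector i := by
  have h0 : sliceIncl i v = sliceIns i 0 v := by simp [sliceIns]
  rw [sliceSector, Set.mem_preimage, h0]
  simp only [sector, Set.mem_ofPred_eq, sliceIns_apply_inr]

lemma measurableSet_sector (i : Fin k) : MeasurableSet (sector i) := by
  have hm (s : Fin k ⊕ Fin k) : Measurable (fun z : Space k => |z s|) := by
    refine Continuous.measurable ?_
    fun_prop
  have : sector i = {z : Space k | z (Sum.inr i) ≠ 0} ∩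
      ⋂ l, ({z : Space k | |z (Sum.inr l)| ≤ |z (Sum.inr i)|} ∩
        ⋂ _ : l < i, {z : Space k | |z (Sum.inr l)| < |z (Sum.inr i)|}) := by
    ext z
    simp [sector]
  rw [this]
  refine MeasurableSet.inter ?_ (MeasurableSet.iInter fun l => (measurableSet_le (hm _) (hm _)).inter
    (MeasurableSet.iInter fun _ => measurableSet_lt (hm _) (hm _)))
  have h : Measurable (fun z : Space k => z (Sum.inr i)) := by
    refine Continuous.measurable ?_
    fun_prop
  exact h (measurableSet_singleton 0).compl

lemma measurableSet_sliceSector (i : Fin k) : MeasurableSet (sliceSector i) :=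
  (sliceIncl i).continuous.measurable (measurableSet_sector i)

lemma sliceSector_subset (i : Fin k) : sliceSector i ⊆ {v | sliceY i v ≠ 0} := by
  intro v hv
  have := hv.1
  rwa [sliceIncl_apply_ne i v (by simp)] at this

lemma pairwise_disjoint_sector : Pairwise (Function.onFun Disjoint (sector (k := k))) := by
  intro i j hij
  rw [Function.onFun, Set.disjoint_left]
  intro z hi hj
  rcases lt_or_gt_of_ne hij with h | h
  · exact absurd ((hj.2 i).2 h) (not_lt.2 (hi.2 j).1)
  · exact absurd ((hi.2 j).2 h) (not_lt.2 (hj.2 i).1)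

lemma iUnion_sector : ⋃ i, sector (k := k) i = {z | ∀ l, z (Sum.inr l) = 0}ᶜ := by
  ext z
  simp only [Set.mem_iUnion, Set.mem_compl_iff, Set.mem_ofPred_eq, not_forall]
  constructor
  · rintro ⟨i, hi⟩
    exact ⟨i, hi.1⟩
  · rintro ⟨l, hl⟩
    have hne : (Finset.univ : Finset (Fin k)).Nonempty := ⟨l, Finset.mem_univ l⟩
    obtain ⟨j, -, hj⟩ := Finset.exists_max_image Finset.univ (fun l => |z (Sum.inr l)|) hne
    let T := Finset.univ.filter (fun i : Fin k => |z (Sum.inr j)| ≤ |z (Sum.inr i)|)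
    have hT : T.Nonempty := ⟨j, by simp [T]⟩
    have hmem := T.min'_mem hT
    have hmax (l : Fin k) : |z (Sum.inr l)| ≤ |z (Sum.inr (T.min' hT))| :=
      (hj l (Finset.mem_univ l)).trans (Finset.mem_filter.1 hmem).2
    refine ⟨T.min' hT, ?_, fun l' => ⟨hmax l', fun hlt => ?_⟩⟩
    · have := (abs_pos.2 hl).trans_le (hmax l)
      exact abs_pos.1 this
    · by_contra hcon
      have : l' ∈ T := by
        simp only [T, Finset.mem_filter, Finset.mem_univ, true_and]
        exact (Finset.mem_filter.1 hmem).2.trans (not_lt.1 hcon)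
      exact absurd (T.min'_le l' this) (not_le.2 hlt)

lemma finrank_slice (i : Fin k) : finrank ℝ (Slice k i) = 2 * k - 1 := by
  rw [finrank_euclideanSpace]
  simp [Fintype.card_subtype_compl, two_mul]

/-- The set y = 0, the only one missed by the sectors, is a smooth image of ℝ^k and so has dimension
at most k. It is used with n = 2k - 1 on the quadric and with n = 2k for Lebesgue measure. -/
lemma euclideanHausdorffMeasure_zero_set {n : ℕ} (hn : k < n) :
    (μHE[n] : Measure (Space k)) {z | ∀ l, z (Sum.inr l) = 0} = 0 := by
  let f : EuclideanSpace ℝ (Fin k) → Space k := fun x => WithLp.toLp 2 (Sum.elim x 0)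
  have hf : ContDiff ℝ 1 f := by
    refine contDiff_euclidean.2 fun s => ?_
    rcases s with l | l
    · simp only [f, Sum.elim_inl]
      fun_prop
    · simp only [f, Sum.elim_inr, Pi.zero_apply]
      fun_prop
  have h1 : dimH (Set.range f) ≤ k := by
    have := hf.dimH_range_le
    rwa [finrank_euclideanSpace, Fintype.card_fin] at this
  have h2 : μH[((n : ℝ≥0) : ℝ)] (Set.range f) = 0 := by
    refine hausdorffMeasure_of_dimH_lt (h1.trans_lt ?_)
    exact_mod_cast hn
  have h3 : {z : Space k | ∀ l, z (Sum.inr l) = 0} ⊆ Set.range f := by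
    intro z hz
    refine ⟨WithLp.toLp 2 (fun l => z (Sum.inl l)), ?_⟩
    ext s
    rcases s with l | l
    · simp [f]
    · simp [f, hz l]
  refine measure_mono_null h3 ?_
  rw [Measure.euclideanHausdorffMeasure_def, Measure.smul_apply]
  simp only [NNReal.coe_natCast] at h2
  rw [h2, smul_zero]

lemma continuous_A0 : Continuous (A0 (k := k)) := by
  unfold A0
  refine (PiLp.continuous_toLp 2 _).comp (continuous_pi fun s => ?_)
  fun_prop

lemma hasFDerivAt_F0 (z : Space k) : HasFDerivAt (F0 (k := k)) (innerSL ℝ (A0 z)) z := by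
  have hc (s : Fin k ⊕ Fin k) : HasFDerivAt (fun z : Space k => z s)
      (EuclideanSpace.proj s : Space k →L[ℝ] ℝ) z :=
    (EuclideanSpace.proj s : Space k →L[ℝ] ℝ).hasFDerivAt
  have h : HasFDerivAt (F0 (k := k)) (∑ l : Fin k,
      (z (Sum.inl l) • (EuclideanSpace.proj (Sum.inr l) : Space k →L[ℝ] ℝ)
        + z (Sum.inr l) • (EuclideanSpace.proj (Sum.inl l) : Space k →L[ℝ] ℝ))) z := by
    unfold F0
    exact HasFDerivAt.fun_sum fun l _ => (hc (Sum.inl l)).mul (hc (Sum.inr l))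
  refine h.congr_fderiv ?_
  ext w
  rw [innerSL_apply_apply, PiLp.inner_apply, Fintype.sum_sum_type, ← Finset.sum_add_distrib,
    sum_apply]
  refine Finset.sum_congr rfl fun l _ => ?_
  simp [A0]
  ring

lemma continuous_F0 : Continuous (F0 (k := k)) :=
  continuous_iff_continuousAt.2 fun z => (hasFDerivAt_F0 z).continuousAt

/-- The point of `Σ_t` over `v`. -/
def sliceGraph (i : Fin k) (t : ℝ) (v : Slice k i) : Space k := sliceIns i (sliceG i t v) v

lemma continuous_sliceY (i : Fin k) : Continuous (sliceY i) := by
  unfold sliceY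
  fun_prop

lemma continuous_sliceF (i : Fin k) : Continuous (sliceF i) :=
  continuous_F0.comp (sliceIncl i).continuous

lemma measurable_sliceG (i : Fin k) (t : ℝ) : Measurable (sliceG i t) :=
  (measurable_const.sub (continuous_sliceF i).measurable).div (continuous_sliceY i).measurable

lemma continuous_sliceIns (i : Fin k) :
    Continuous (fun p : ℝ × Slice k i => sliceIns i p.1 p.2) := by
  unfold sliceIns
  have := (sliceIncl i).continuous
  fun_prop

lemma measurable_sliceGraph (i : Fin k) (t : ℝ) : Measurable (sliceGraph i t) :=
  (continuous_sliceIns i).measurable.comp ((measurable_sliceG i t).prodMk measurable_id)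

/-- The gradient of `sliceG`. -/
def sliceGrad (i : Fin k) (t : ℝ) (v : Slice k i) : Slice k i :=
  (-(sliceY i v)⁻¹) • sliceProj i (A0 (sliceGraph i t v))

lemma A0_sliceIns (i : Fin k) (ξ : ℝ) (v : Slice k i) : A0 (sliceIns i ξ v)
    = A0 (sliceIncl i v) + ξ • EuclideanSpace.single (Sum.inr i) (1 : ℝ) := by
  ext s
  rcases s with l | l <;> simp [A0, sliceIns, sliceNormal, PiLp.single_apply]

lemma hasFDerivAt_sliceG (i : Fin k) (t : ℝ) {v : Slice k i} (hv : sliceY i v ≠ 0) :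
    HasFDerivAt (sliceG i t) (innerSL ℝ (sliceGrad i t v)) v := by
  have hY : HasFDerivAt (sliceY i) (EuclideanSpace.proj ⟨Sum.inr i, by simp⟩ : Slice k i →L[ℝ] ℝ) v :=
    (EuclideanSpace.proj ⟨Sum.inr i, by simp⟩ : Slice k i →L[ℝ] ℝ).hasFDerivAt
  have hF : HasFDerivAt (sliceF i)
      ((innerSL ℝ (A0 (sliceIncl i v))).comp (sliceIncl i).toContinuousLinearMap) v :=
    (hasFDerivAt_F0 _).comp v (sliceIncl i).toContinuousLinearMap.hasFDerivAt
  have h := ((hasFDerivAt_const t v).sub hF).mul ((hasDerivAt_inv hv).comp_hasFDerivAt v hY)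
  have h2 : sliceG i t = fun v => (t - sliceF i v) * (sliceY i v)⁻¹ := by
    ext v
    rw [sliceG, div_eq_mul_inv]
  rw [h2]
  refine h.congr_fderiv ?_
  ext w
  have h3 : inner ℝ (sliceProj i (A0 (sliceGraph i t v))) w
      = inner ℝ (A0 (sliceIncl i v)) (sliceIncl i w) + sliceG i t v * sliceY i w := by
    rw [← inner_sliceIncl, sliceGraph, A0_sliceIns, inner_add_left, inner_smul_left,
      EuclideanSpace.inner_single_left, sliceIncl_apply_ne i w (by simp)]
    simp [sliceY]
  have h4 : (EuclideanSpace.proj ⟨Sum.inr i, by simp⟩ : Slice k i →L[ℝ] ℝ) w = sliceY i w := rfl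
  simp only [innerSL_apply_apply, sliceGrad, inner_smul_left, h3, add_apply,
    smul_apply, sub_apply, zero_apply,
    ContinuousLinearMap.comp_apply, smul_eq_mul, Function.comp, h4]
  simp only [sliceG, LinearIsometry.coe_toContinuousLinearMap, Pi.sub_apply]
  simp
  field_simp
  ring

lemma sliceY_eq (i : Fin k) (ξ : ℝ) (v : Slice k i) :
    A0 (sliceIns i ξ v) (Sum.inl i) = sliceY i v := sliceIns_apply_inr i ξ v i

/-- The gradient is -1/y_i times the projection of Az, and the coordinate lost in the projection is
y_i; so 1 + |∇g|² = |Az|²/y_i² by Pythagoras. -/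
lemma graphJac_sliceGrad (i : Fin k) (t : ℝ) {v : Slice k i} (hv : sliceY i v ≠ 0) :
    graphJac (innerSL ℝ (sliceGrad i t v)) = ‖A0 (sliceGraph i t v)‖ * |sliceY i v|⁻¹ := by
  have h1 := norm_sq_sliceProj i (A0 (sliceGraph i t v))
  rw [sliceGraph, sliceY_eq, ← sliceGraph] at h1
  have h2 : 0 < |sliceY i v| := abs_pos.2 hv
  rw [graphJac, innerSL_apply_norm, sliceGrad, norm_smul, norm_neg, norm_inv, Real.norm_eq_abs,
    Real.sqrt_eq_iff_eq_sq (by positivity) (by positivity), mul_pow, mul_pow, h1, inv_pow, sq_abs]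
  field_simp
  ring

lemma continuousOn_sliceGrad (i : Fin k) (t : ℝ) :
    ContinuousOn (fun v => innerSL ℝ (sliceGrad i t v)) {v | sliceY i v ≠ 0} := by
  refine (innerSL ℝ).continuous.comp_continuousOn ?_
  have hY : ContinuousOn (sliceY i) {v | sliceY i v ≠ 0} := (continuous_sliceY i).continuousOn
  have hF : ContinuousOn (sliceF i) {v | sliceY i v ≠ 0} := (continuous_sliceF i).continuousOn
  have hG : ContinuousOn (sliceG i t) {v | sliceY i v ≠ 0} :=
    (continuousOn_const.sub hF).div hY fun v hv => hv
  have hI : ContinuousOn (sliceGraph i t) {v | sliceY i v ≠ 0} :=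
    (continuous_sliceIns i).comp_continuousOn (hG.prodMk continuousOn_id)
  have hP : Continuous (sliceProj i) := (sliceProj i).continuous_of_finiteDimensional
  exact (hY.inv₀ fun v hv => hv).neg.smul (hP.comp_continuousOn (continuous_A0.comp_continuousOn hI))

/-- F₀ is affine in x_i with slope y_i ≠ 0 on the sector, so every line in the direction x_i meets
Σ_t exactly once. -/
lemma image_sliceGraph (i : Fin k) (t : ℝ) :
    sliceGraph i t '' sliceSector i = quadric k t ∩ sector i := by
  ext z
  constructor
  · rintro ⟨v, hv, rfl⟩
    have h0 : sliceY i v ≠ 0 := sliceSector_subset i hv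
    refine ⟨?_, sliceIns_mem_sector.2 hv⟩
    rw [quadric, Set.mem_ofPred_eq, Ft, sliceGraph, F0_sliceIns, sliceG]
    field_simp
    ring
  · rintro ⟨hz, hs⟩
    have hz' : z = sliceIns i (z (Sum.inl i)) (sliceProj i z) := by
      ext s
      by_cases h : s = Sum.inl i
      · subst h
        rw [sliceIns_apply_self]
      · rw [sliceIns_apply_ne i _ _ h]
        rfl
    have hv : sliceProj i z ∈ sliceSector i := by
      rw [hz'] at hs
      exact sliceIns_mem_sector.1 hs
    refine ⟨sliceProj i z, hv, ?_⟩
    have h0 : sliceY i (sliceProj i z) ≠ 0 := sliceSector_subset i hv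
    have h1 : F0 z = t := sub_eq_zero.1 hz
    rw [hz', F0_sliceIns] at h1
    rw [sliceGraph, sliceG]
    conv_rhs => rw [hz']
    congr 1
    rw [div_eq_iff h0]
    linarith

/-- The measure `|y_i|⁻¹ dv` on the region of the coordinate hyperplane where `y_i` is the first of
the largest coordinates of `y`. -/
def sliceMeasure (i : Fin k) : Measure (Slice k i) :=
  (volume.restrict (sliceSector i)).withDensity (fun v => ENNReal.ofReal |sliceY i v|⁻¹)

lemma measurable_norm_A0 : Measurable (fun z : Space k => ENNReal.ofReal ‖A0 z‖⁻¹) :=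
  (continuous_A0.measurable.norm.inv).ennreal_ofReal

/-- The area element |Az|/|y_i| cancels the density |Az|⁻¹ and leaves |y_i|⁻¹; Az is nonzero there
because y_i is one of its coordinates. -/
lemma restrict_quadric_sector (i : Fin k) (t : ℝ) :
    ((μHE[2 * k - 1] : Measure (Space k)).restrict (quadric k t ∩ sector i)).withDensity
      (fun z => ENNReal.ofReal ‖A0 z‖⁻¹) = (sliceMeasure i).map (sliceGraph i t) := by
  have hm := measurable_sliceGraph i t
  have hU : IsOpen {v : Slice k i | sliceY i v ≠ 0} :=
    isOpen_ne.preimage (continuous_sliceY i)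
  have h := restrict_graph_eq_map (sliceIncl i) (norm_sliceNormal i)
    (inner_sliceIncl_sliceNormal i) hU (fun v hv => hasFDerivAt_sliceG i t hv)
    (continuousOn_sliceGrad i t) (measurable_sliceG i t) (measurableSet_sliceSector i)
    (sliceSector_subset i)
  have hgm : graphMap (sliceIncl i) (sliceNormal i) (sliceG i t) = sliceGraph i t := rfl
  rw [finrank_slice, hgm, image_sliceGraph] at h
  rw [h]
  ext A hA
  have hJ : ∀ v ∈ sliceSector i, ENNReal.ofReal (graphJac (innerSL ℝ (sliceGrad i t v)))
      = ENNReal.ofReal (‖A0 (sliceGraph i t v)‖ * |sliceY i v|⁻¹) := fun v hv => by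
    rw [graphJac_sliceGrad i t (sliceSector_subset i hv)]
  have hmJ : Measurable (fun v => ENNReal.ofReal (‖A0 (sliceGraph i t v)‖ * |sliceY i v|⁻¹)) :=
    (((continuous_A0.measurable.comp hm).norm).mul
      ((continuous_sliceY i).measurable.abs.inv)).ennreal_ofReal
  have hmA : Measurable (fun v => ENNReal.ofReal ‖A0 (sliceGraph i t v)‖⁻¹) :=
    measurable_norm_A0.comp hm
  rw [withDensity_apply _ hA, setLIntegral_map hA measurable_norm_A0 hm, Measure.map_apply hm hA,
    sliceMeasure, withDensity_apply _ (hm hA),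
    withDensity_congr_ae ((ae_restrict_iff' (measurableSet_sliceSector i)).2
      (Eventually.of_forall hJ)),
    setLIntegral_withDensity_eq_setLIntegral_mul _ hmJ hmA (hm hA)]
  rw [Measure.restrict_restrict (hm hA)]
  refine setLIntegral_congr_fun ((hm hA).inter (measurableSet_sliceSector i)) fun v hv => ?_
  have h0 : sliceY i v ≠ 0 := sliceSector_subset i hv.2
  have h1 : ‖A0 (sliceGraph i t v)‖ ≠ 0 := by
    intro hcon
    have h2 := sliceY_eq i (sliceG i t v) v
    rw [← sliceGraph, norm_eq_zero.1 hcon] at h2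
    exact h0 h2.symm
  simp only [Pi.mul_apply]
  rw [← ENNReal.ofReal_mul (by positivity)]
  congr 1
  field_simp

/-- The measure on the quadric, in terms of Lebesgue measure on coordinate hyperplanes. -/
theorem quadricMeasure_eq_sum (hk : 2 ≤ k) (t : ℝ) :
    quadricMeasure k t = ∑ i, (sliceMeasure i).map (sliceGraph i t) := by
  have hq : MeasurableSet (quadric k t) := by
    have : Measurable (fun z : Space k => Ft t z) := by
      unfold Ft
      exact (continuous_F0.sub continuous_const).measurable
    exact this (measurableSet_singleton 0)
  have hae : (quadric k t : Set (Space k)) =ᵐ[μHE[2 * k - 1]] ⋃ i, (quadric k t ∩ sector i) := by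
    rw [← Set.inter_iUnion, iUnion_sector]
    have h0 := euclideanHausdorffMeasure_zero_set (k := k) (n := 2 * k - 1) (by omega)
    refine (inter_ae_eq_left_of_ae_eq_univ ?_).symm
    rwa [ae_eq_univ, compl_compl]
  rw [quadricMeasure, Measure.restrict_congr_set hae, Measure.restrict_iUnion
    (fun i j hij => (pairwise_disjoint_sector hij).mono Set.inter_subset_right Set.inter_subset_right)
    (fun i => hq.inter (measurableSet_sector i)), withDensity_sum, Measure.sum_fintype]
  exact Finset.sum_congr rfl fun i _ => restrict_quadric_sector i t

lemma measurePreserving_sliceIns (i : Fin k) :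
    MeasurePreserving (fun p : ℝ × Slice k i => sliceIns i p.1 p.2) := by
  let p : Fin k ⊕ Fin k → Prop := fun s => s = Sum.inl i
  have h1 : MeasurePreserving (MeasurableEquiv.funUnique {s // p s} ℝ).symm :=
    (volume_preserving_funUnique {s // p s} ℝ).symm
  have h2 : MeasurePreserving (WithLp.ofLp : Slice k i → _) := PiLp.volume_preserving_ofLp _
  have h3 : MeasurePreserving (MeasurableEquiv.piEquivPiSubtypeProd (fun _ => ℝ) p).symm :=
    by convert! (volume_preserving_piEquivPiSubtypeProd (fun _ => ℝ) p).symm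
  have h4 := (PiLp.volume_preserving_toLp (Fin k ⊕ Fin k)).comp (h3.comp (h1.prod h2))
  refine (congrArg (fun F => MeasurePreserving F (volume.prod volume) volume) ?_).mpr h4
  ext ⟨ξ, v⟩ s
  by_cases h : s = Sum.inl i
  · subst h
    rw [sliceIns_apply_self]
    simp [MeasurableEquiv.piEquivPiSubtypeProd, Equiv.piEquivPiSubtypeProd, p]
  · rw [sliceIns_apply_ne i ξ v h]
    simp [MeasurableEquiv.piEquivPiSubtypeProd, Equiv.piEquivPiSubtypeProd, p, h]

lemma preimage_sliceIns_sector (i : Fin k) :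
    (fun p : ℝ × Slice k i => sliceIns i p.1 p.2) ⁻¹' sector i = Set.univ ×ˢ sliceSector i := by
  ext p
  simp only [Set.mem_preimage, sliceIns_mem_sector, Set.mem_prod, Set.mem_univ, true_and]

lemma measurableEmbedding_sliceIns (i : Fin k) :
    MeasurableEmbedding (fun p : ℝ × Slice k i => sliceIns i p.1 p.2) := by
  refine (continuous_sliceIns i).measurableEmbedding fun p q h => ?_
  have h1 : p.1 = q.1 := by
    have := congrArg (fun z : Space k => z (Sum.inl i)) h
    simpa [sliceIns_apply_self] using this
  refine Prod.ext h1 ?_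
  ext s
  have := congrArg (fun z : Space k => z s) h
  simpa [sliceIns_apply_ne i _ _ s.2] using this

lemma measurePreserving_sliceIns_sector (i : Fin k) :
    MeasurePreserving (fun p : ℝ × Slice k i => sliceIns i p.1 p.2)
      ((volume : Measure ℝ).prod (volume.restrict (sliceSector i))) (volume.restrict (sector i)) := by
  have h := (measurePreserving_sliceIns i).restrict_preimage_emb (measurableEmbedding_sliceIns i)
    (sector i)
  rwa [preimage_sliceIns_sector, Measure.volume_eq_prod, ← Measure.prod_restrict,
    Measure.restrict_univ] at h

lemma integrable_slice {f : Space k → ℝ} (hf : Integrable f) (i : Fin k) :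
    Integrable (fun p : Slice k i × ℝ => f (sliceIns i p.2 p.1))
      ((volume.restrict (sliceSector i)).prod volume) :=
  (((measurePreserving_sliceIns_sector i).integrable_comp_emb
    (measurableEmbedding_sliceIns i)).2 hf.integrableOn).swap

/-- Integration over the sectors, one line in the direction `x_i` at a time. -/
lemma integral_eq_sum_sector (hk : 1 ≤ k) {f : Space k → ℝ} (hf : Integrable f) :
    ∫ z, f z = ∑ i, ∫ v in sliceSector i, ∫ ξ, f (sliceIns i ξ v) := by
  have h0 : (volume : Measure (Space k)) {z | ∀ l, z (Sum.inr l) = 0} = 0 := by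
    rw [← InnerProductSpace.euclideanHausdorffMeasure_eq_volume, finrank_euclideanSpace]
    refine euclideanHausdorffMeasure_zero_set ?_
    simp only [Fintype.card_sum, Fintype.card_fin]
    omega
  have h1 : (volume : Measure (Space k)) = volume.restrict (⋃ i, sector i) := by
    rw [iUnion_sector]
    exact (Measure.restrict_eq_self_of_ae_mem (measure_eq_zero_iff_ae_notMem.1 h0)).symm
  have h2 (i : Fin k) : ∫ z in sector i, f z = ∫ v in sliceSector i, ∫ ξ, f (sliceIns i ξ v) := by
    rw [← (measurePreserving_sliceIns_sector i).integral_comp (measurableEmbedding_sliceIns i),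
      ← integral_prod_swap]
    exact integral_prod _ (integrable_slice hf i)
  conv_lhs => rw [h1]
  rw [integral_iUnion_fintype measurableSet_sector
    (fun i j h => pairwise_disjoint_sector h) fun i => hf.integrableOn]
  exact Finset.sum_congr rfl fun i _ => h2 i

end

/-! ### Integrable majorants and the approximation of the singular integral. -/

section

open scoped NNReal ENNReal Topology
open Filter Module

/-- The two conditions are integrability at 0 and at infinity; this is one factor of a product
majorant. -/
lemma integrable_abs_rpow_mul_max_rpow {α β : ℝ} (hα : α < 1) (hαβ : 1 < α + β) :
    Integrable (fun t : ℝ => |t| ^ (-α) * max 1 |t| ^ (-β)) := by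
  set f : ℝ → ℝ := fun t => |t| ^ (-α) * max 1 |t| ^ (-β)
  have h1 : IntegrableOn f (Set.Ioc 0 1) := by
    have h := (intervalIntegrable_iff_integrableOn_Ioc_of_le zero_le_one).1
      (intervalIntegral.intervalIntegrable_rpow' (a := 0) (b := 1) (r := -α) (by linarith))
    refine h.congr_fun (fun t ht => ?_) measurableSet_Ioc
    simp only [f]
    rw [abs_of_pos ht.1, max_eq_left ht.2, Real.one_rpow, mul_one]
  have h2 : IntegrableOn f (Set.Ioi 1) := by
    have h := integrableOn_Ioi_rpow_of_lt (a := -(α + β)) (by linarith) one_pos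
    refine h.congr_fun (fun t ht => ?_) measurableSet_Ioi
    have ht' : (1 : ℝ) < t := ht
    have ht0 : 0 < t := by linarith
    simp only [f]
    rw [abs_of_pos ht0, max_eq_right ht'.le, ← Real.rpow_add ht0, neg_add]
  have h3 : IntegrableOn f (Set.Ioi 0) := by
    rw [← Set.Ioc_union_Ioi_eq_Ioi zero_le_one]
    exact h1.union h2
  have h4 : IntegrableOn f (Set.Iio 0) := by
    have h := IntegrableOn.comp_neg_Iio (c := 0) (f := f) (by simpa using h3)
    simpa [f] using h
  have h5 : IntegrableOn f (Set.Iic 0) := (integrableOn_Iic_iff_integrableOn_Iio (by simp)).2 h4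
  rw [← integrableOn_univ, ← Set.Iic_union_Ioi (a := (0 : ℝ))]
  exact h5.union h3

variable {k : ℕ}

/-- The exponents of `|y_l|` in the majorant. -/
def absExp (a : ℝ) : Fin k ⊕ Fin k → ℝ := Sum.elim (fun _ => 0) (fun _ => a)

/-- The exponents of `⟨z_s⟩` in the majorant. -/
def maxExp (k : ℕ) (a : ℝ) : Fin k ⊕ Fin k → ℝ :=
  Sum.elim (fun _ => 1 + k * a / (2 * (k - 1))) (fun _ => 1 - a / 2)

lemma sum_subtype_ne_inl (i : Fin k) (f : Fin k ⊕ Fin k → ℝ) :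
    ∑ s : {s : Fin k ⊕ Fin k // s ≠ Sum.inl i}, f s
      = ∑ l, f (Sum.inl l) + ∑ l, f (Sum.inr l) - f (Sum.inl i) := by
  rw [← Fintype.sum_sum_type, ← Fintype.sum_subtype_add_sum_subtype (fun s => s ≠ Sum.inl i) f]
  have : ∑ s : {s // ¬ s ≠ (Sum.inl i : Fin k ⊕ Fin k)}, f s = f (Sum.inl i) := by
    rw [← Finset.sum_subtype ({Sum.inl i} : Finset (Fin k ⊕ Fin k)) (by simp) f]
    simp
  rw [this]
  ring

lemma le_bracket_sliceIncl (i : Fin k) (v : Slice k i) (s : {s : Fin k ⊕ Fin k // s ≠ Sum.inl i}) :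
    max 1 |v s| ≤ bracket (sliceIncl i v) := by
  refine max_le_max le_rfl ?_
  rw [LinearIsometry.norm_map, ← Real.norm_eq_abs]
  exact PiLp.norm_apply_le v s

lemma bracket_pos (z : Space k) : 0 < bracket z := lt_max_of_lt_left one_pos

lemma abs_le_sliceY {i : Fin k} {v : Slice k i} (hv : v ∈ sliceSector i) (l : Fin k) :
    |v ⟨Sum.inr l, by simp⟩| ≤ |sliceY i v| := by
  have := (hv.2 l).1
  rwa [sliceIncl_apply_ne i v (by simp), sliceIncl_apply_ne i v (by simp)] at this

/-- The majorant of the derivatives along the lines of the coordinate `x_i`. -/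
def sliceMajorant (i : Fin k) (j : ℕ) (v : Slice k i) : ℝ :=
  |sliceY i v| ^ (-(1 + j : ℝ)) * bracket (sliceIncl i v) ^ (-(2 * (k : ℝ) - 1))

lemma sliceMajorant_nonneg (i : Fin k) (j : ℕ) (v : Slice k i) : 0 ≤ sliceMajorant i j v :=
  mul_nonneg (Real.rpow_nonneg (abs_nonneg _) _) (Real.rpow_nonneg (bracket_pos _).le _)

lemma measurable_sliceMajorant (i : Fin k) (j : ℕ) : Measurable (sliceMajorant i j) := by
  have h1 : Measurable (fun v => bracket (sliceIncl i v)) :=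
    measurable_const.max (sliceIncl i).continuous.measurable.norm
  exact ((continuous_sliceY i).measurable.abs.pow_const _).mul (h1.pow_const _)

/-- Since |y_i| dominates all |y_l|, the power 1 + j is spread evenly over the k coordinates of y,
with exponent a = (1+j)/k each. The power 2k - 1 of the bracket is divided as (k-1)(1 + ka/(2(k-1)))
+ k(1 - a/2). Then each x_l decays with exponent above 1 and each y_l with a + 1 - a/2 = 1 + a/2.
Zero coordinates are excluded because `0 ^ (-a)` is 0 for a ≠ 0. -/
lemma sliceMajorant_le (hk : 2 ≤ k) (i : Fin k) (j : ℕ) (hj : j + 2 ≤ k) {v : Slice k i}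
    (hv : v ∈ sliceSector i) (h0 : ∀ s, v s ≠ 0) :
    sliceMajorant i j v ≤ ∏ s : {s : Fin k ⊕ Fin k // s ≠ Sum.inl i},
      (|v s| ^ (-absExp ((1 + j : ℝ) / k) (s : Fin k ⊕ Fin k))
        * max 1 |v s| ^ (-maxExp k ((1 + j : ℝ) / k) s)) := by
  have hk0 : (0 : ℝ) < k := by positivity
  have hk1 : (2 : ℝ) ≤ k := by exact_mod_cast hk
  have hj' : (j : ℝ) + 2 ≤ k := by exact_mod_cast hj
  have hj0 : (0 : ℝ) ≤ j := j.cast_nonneg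
  set a : ℝ := (1 + j : ℝ) / k with ha
  have ha0 : 0 ≤ a := by positivity
  have ha1 : a ≤ 1 := by
    rw [ha, div_le_one hk0]
    linarith
  have hka : k * a = 1 + j := by
    rw [ha]
    field_simp
  have hY : 0 < |sliceY i v| := abs_pos.2 (sliceSector_subset i hv)
  have hS1 : ∑ s : {s : Fin k ⊕ Fin k // s ≠ Sum.inl i}, -absExp a (s : Fin k ⊕ Fin k)
      = -(1 + j : ℝ) := by
    rw [Finset.sum_neg_distrib, sum_subtype_ne_inl i (absExp a)]
    simp [absExp, hka]
  have hS2 : ∑ s : {s : Fin k ⊕ Fin k // s ≠ Sum.inl i}, -maxExp k a (s : Fin k ⊕ Fin k)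
      = -(2 * (k : ℝ) - 1) := by
    rw [Finset.sum_neg_distrib, sum_subtype_ne_inl i (maxExp k a)]
    have : (k : ℝ) - 1 ≠ 0 := by linarith
    simp [maxExp]
    field_simp
    ring
  have hM : ∀ s : Fin k ⊕ Fin k, 0 ≤ maxExp k a s := by
    rintro (l | l)
    · simp only [maxExp, Sum.elim_inl]
      have : 0 ≤ k * a / (2 * ((k : ℝ) - 1)) := div_nonneg (by positivity) (by linarith)
      linarith
    · simp only [maxExp, Sum.elim_inr]
      linarith
  rw [sliceMajorant, ← hS1, ← hS2, Real.rpow_sum_of_pos hY, Real.rpow_sum_of_pos (bracket_pos _),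
    ← Finset.prod_mul_distrib]
  refine Finset.prod_le_prod (fun s _ => ?_) fun s _ => ?_
  · exact mul_nonneg (Real.rpow_nonneg (abs_nonneg _) _) (Real.rpow_nonneg (bracket_pos _).le _)
  · refine mul_le_mul ?_ ?_ (Real.rpow_nonneg (bracket_pos _).le _)
      (Real.rpow_nonneg (abs_nonneg _) _)
    · rcases s with ⟨l | l, hs⟩
      · simp [absExp]
      · exact Real.rpow_le_rpow_of_nonpos (abs_pos.2 (h0 _)) (abs_le_sliceY hv l)
          (by simpa [absExp] using ha0)
    · exact Real.rpow_le_rpow_of_nonpos (lt_max_of_lt_left one_pos) (le_bracket_sliceIncl i v s)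
        (neg_nonpos.2 (hM s))

/-- The condition j + 2 ≤ k makes a < 1; it is what limits the usable derivatives to k - 2. -/
lemma integrableOn_sliceMajorant (hk : 2 ≤ k) (i : Fin k) (j : ℕ) (hj : j + 2 ≤ k) :
    IntegrableOn (sliceMajorant i j) (sliceSector i) := by
  have hk0 : (0 : ℝ) < k := by positivity
  have hk1 : (2 : ℝ) ≤ k := by exact_mod_cast hk
  have hj' : (j : ℝ) + 2 ≤ k := by exact_mod_cast hj
  have hj0 : (0 : ℝ) ≤ j := j.cast_nonneg
  set a : ℝ := (1 + j : ℝ) / k with ha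
  have ha0 : 0 < a := by positivity
  have ha1 : a < 1 := by
    rw [ha, div_lt_one hk0]
    linarith
  have h1 : Integrable (fun x : {s : Fin k ⊕ Fin k // s ≠ Sum.inl i} → ℝ => ∏ s,
      (|x s| ^ (-absExp a (s : Fin k ⊕ Fin k)) * max 1 |x s| ^ (-maxExp k a s))) := by
    refine Integrable.fintype_prod (f := fun (s : {s : Fin k ⊕ Fin k // s ≠ Sum.inl i}) (t : ℝ) =>
      |t| ^ (-absExp a (s : Fin k ⊕ Fin k)) * max 1 |t| ^ (-maxExp k a s)) fun s => integrable_abs_rpow_mul_max_rpow ?_ ?_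
    · rcases s with ⟨l | l, hs⟩ <;> simp [absExp, ha1]
    · rcases s with ⟨l | l, hs⟩
      · simp only [absExp, maxExp, Sum.elim_inl]
        have : 0 < k * a / (2 * ((k : ℝ) - 1)) := div_pos (by positivity) (by linarith)
        linarith
      · simp only [absExp, maxExp, Sum.elim_inr]
        linarith
  have h2 : Integrable (fun v : Slice k i => ∏ s,
      (|v s| ^ (-absExp a (s : Fin k ⊕ Fin k)) * max 1 |v s| ^ (-maxExp k a s))) :=
    (PiLp.volume_preserving_ofLp _).integrable_comp_of_integrable h1
  refine h2.integrableOn.mono' (measurable_sliceMajorant i j).aestronglyMeasurable ?_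
  have hne : ∀ᵐ v : Slice k i, ∀ s, v s ≠ 0 := by
    refine ae_all_iff.2 fun s => ?_
    exact (PiLp.volume_preserving_ofLp _).quasiMeasurePreserving.ae
      (Measure.ae_eval_ne (fun _ => volume) s 0)
  filter_upwards [ae_restrict_mem (measurableSet_sliceSector i), ae_restrict_of_ae hne] with v hv hv0
  rw [Real.norm_eq_abs, abs_of_nonneg (sliceMajorant_nonneg i j v)]
  exact sliceMajorant_le hk i j hj hv hv0

lemma abs_partialDeriv_mul_le {n₁ : ℕ} {n₂ : ℝ} {f : Space k → ℝ} (hf : weightedNorm n₁ n₂ f ≠ ⊤)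
    {n : ℕ} (hn : n ≤ n₁) (i : Fin n → Fin k ⊕ Fin k) (z : Space k) :
    |partialDeriv f i z| * bracket z ^ n₂ ≤ (weightedNorm n₁ n₂ f).toReal := by
  rw [← ENNReal.ofReal_le_iff_le_toReal hf]
  exact le_iSup_of_le z (le_iSup_of_le (⟨n, by omega⟩ : Fin (n₁ + 1)) (le_iSup_of_le i le_rfl))

lemma abs_partialDeriv_le {n₁ : ℕ} {n₂ : ℝ} {f : Space k → ℝ} (hf : weightedNorm n₁ n₂ f ≠ ⊤)
    {n : ℕ} (hn : n ≤ n₁) (i : Fin n → Fin k ⊕ Fin k) (z : Space k) :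
    |partialDeriv f i z| ≤ (weightedNorm n₁ n₂ f).toReal * bracket z ^ (-n₂) := by
  have hb := bracket_pos z
  rw [Real.rpow_neg hb.le, ← div_eq_mul_inv, le_div_iff₀ (Real.rpow_pos_of_pos hb _)]
  exact abs_partialDeriv_mul_le hf hn i z

lemma abs_le_weightedNorm {n₁ : ℕ} {n₂ : ℝ} {f : Space k → ℝ} (hf : weightedNorm n₁ n₂ f ≠ ⊤)
    (z : Space k) : |f z| ≤ (weightedNorm n₁ n₂ f).toReal * bracket z ^ (-n₂) := by
  have h := abs_partialDeriv_le hf (Nat.zero_le n₁) (fun s => s.elim0) z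
  rwa [partialDeriv, iteratedFDeriv_zero_apply] at h

/-- Dropping x_i can only shrink the norm, so weighted bounds on w become uniform along the line. -/
lemma bracket_sliceIncl_le (i : Fin k) (ξ : ℝ) (v : Slice k i) :
    bracket (sliceIncl i v) ≤ bracket (sliceIns i ξ v) := by
  refine max_le_max le_rfl ?_
  rw [LinearIsometry.norm_map]
  have h1 : sliceProj i (sliceIns i ξ v) = v := by
    ext s
    exact sliceIns_apply_ne i ξ v s.2
  refine le_of_sq_le_sq ?_ (norm_nonneg _)
  rw [norm_sq_sliceProj i (sliceIns i ξ v), h1]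
  nlinarith [sq_nonneg (sliceIns i ξ v (Sum.inl i))]

lemma bracket_sliceIns_rpow_le (i : Fin k) (ξ : ℝ) (v : Slice k i) {a : ℝ} (ha : 0 ≤ a) :
    bracket (sliceIns i ξ v) ^ (-a) ≤ bracket (sliceIncl i v) ^ (-a) :=
  Real.rpow_le_rpow_of_nonpos (bracket_pos _) (bracket_sliceIncl_le i ξ v) (neg_nonpos.2 ha)

lemma contDiff_sliceIns {n : WithTop ℕ∞} {f : Space k → ℝ} (hf : ContDiff ℝ n f) (i : Fin k)
    (v : Slice k i) : ContDiff ℝ n (fun τ => f (sliceIns i τ v)) := by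
  unfold sliceIns
  fun_prop

lemma iteratedDeriv_sliceIns {n : ℕ} {f : Space k → ℝ} (hf : ContDiff ℝ n f) (i : Fin k)
    (v : Slice k i) (τ : ℝ) : iteratedDeriv n (fun τ => f (sliceIns i τ v)) τ
      = partialDeriv f (fun _ : Fin n => Sum.inl i) (sliceIns i τ v) := by
  have h1 : ContDiff ℝ n (fun z => f (sliceIncl i v + z)) := hf.comp (contDiff_const.add contDiff_id)
  let g : ℝ →L[ℝ] Space k := ContinuousLinearMap.toSpanSingleton ℝ (sliceNormal i)
  have h2 : (fun τ => f (sliceIns i τ v)) = (fun z => f (sliceIncl i v + z)) ∘ g := by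
    ext τ
    simp [g, sliceIns]
  rw [iteratedDeriv_eq_iteratedFDeriv, h2, g.iteratedFDeriv_comp_right h1 τ le_rfl,
    iteratedFDeriv_comp_add_left, partialDeriv]
  simp [g, sliceIns, sliceNormal]

lemma integrable_bracket_rpow {a : ℝ} (ha : 2 * (k : ℝ) < a) :
    Integrable (fun z : Space k => bracket z ^ (-a)) := by
  have hd : (finrank ℝ (Space k) : ℝ) < a := by
    rw [finrank_euclideanSpace]
    simp only [Fintype.card_sum, Fintype.card_fin]
    push_cast
    linarith
  have ha0 : 0 ≤ a := by
    have : (0 : ℝ) ≤ k := k.cast_nonneg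
    linarith
  have h := (integrable_one_add_norm (μ := (volume : Measure (Space k))) hd).const_mul (2 ^ a)
  refine h.mono' ?_ (Eventually.of_forall fun z => ?_)
  · exact ((measurable_const.max measurable_norm).pow_const _).aestronglyMeasurable
  · have hb := bracket_pos z
    have h1 : (1 + ‖z‖) ≤ 2 * bracket z := by
      have := le_max_left 1 ‖z‖
      have := le_max_right 1 ‖z‖
      unfold bracket
      linarith
    have h0 : 0 < 1 + ‖z‖ := by positivity
    rw [Real.norm_eq_abs, abs_of_nonneg (Real.rpow_nonneg hb.le _), Real.rpow_neg hb.le,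
      Real.rpow_neg h0.le, ← div_eq_mul_inv, inv_eq_one_div,
      div_le_div_iff₀ (Real.rpow_pos_of_pos hb _) (Real.rpow_pos_of_pos h0 _), one_mul,
      ← Real.mul_rpow two_pos.le hb.le]
    exact Real.rpow_le_rpow h0.le h1 ha0

lemma integrable_of_weightedNorm {n₁ : ℕ} {n₂ : ℝ} (h2 : 2 * (k : ℝ) < n₂) {w : Space k → ℝ}
    (hc : Continuous w) (hw : weightedNorm n₁ n₂ w ≠ ⊤) : Integrable w :=
  ((integrable_bracket_rpow h2).const_mul _).mono' hc.aestronglyMeasurable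
    (Eventually.of_forall fun z => abs_le_weightedNorm hw z)

lemma integral_abs_le_of_weightedNorm {n₁ : ℕ} {n₂ : ℝ} (h2 : 2 * (k : ℝ) < n₂) {w : Space k → ℝ}
    (hc : Continuous w) (hw : weightedNorm n₁ n₂ w ≠ ⊤) :
    ∫ z, |w z| ≤ (weightedNorm n₁ n₂ w).toReal * ∫ z : Space k, bracket z ^ (-n₂) := by
  rw [← integral_const_mul]
  exact integral_mono (integrable_of_weightedNorm h2 hc hw).abs
    ((integrable_bracket_rpow h2).const_mul _) fun z => abs_le_weightedNorm hw z

/-- Substitute u = (ξy + b - m)/x, with Jacobian |y|/x; u = 0 is the point where the line meets the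
quadric. -/
lemma integral_line (φ K : ℝ → ℝ) {x y : ℝ} (hx : 0 < x) (hy : y ≠ 0) (b m : ℝ) :
    ∫ ξ, φ ξ * (x⁻¹ * K ((ξ * y + b - m) / x))
      = |y|⁻¹ * ∫ u, φ ((m - b) / y + x / y * u) * K u := by
  set F : ℝ → ℝ := fun ξ => φ ξ * K ((ξ * y + b - m) / x) with hF
  have h1 : (fun u => φ ((m - b) / y + x / y * u) * K u)
      = fun u => (fun s => F ((m - b) / y + s)) (x / y * u) := by
    ext u
    simp only [hF]
    congr 2
    field_simp
    ring
  have h2 : (fun ξ => φ ξ * (x⁻¹ * K ((ξ * y + b - m) / x))) = fun ξ => x⁻¹ * F ξ := by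
    ext ξ
    simp only [hF]
    ring
  rw [h1, Measure.integral_comp_mul_left (fun s => F ((m - b) / y + s)),
    integral_add_left_eq_self, h2, integral_const_mul,
    smul_eq_mul, ← mul_assoc, inv_div, abs_div, abs_of_pos hx]
  congr 1
  have : |y| ≠ 0 := abs_ne_zero.2 hy
  field_simp

lemma abs_inv_mul_sliceGraph_le (hk : 1 ≤ k) {n₁ : ℕ} {w : Space k → ℝ}
    (hw : weightedNorm n₁ (2 * (k : ℝ) - 1) w ≠ ⊤) (i : Fin k) (m : ℝ) (v : Slice k i) :
    |(|sliceY i v|⁻¹ * w (sliceGraph i m v))|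
      ≤ (weightedNorm n₁ (2 * (k : ℝ) - 1) w).toReal * sliceMajorant i 0 v := by
  have ha : (0 : ℝ) ≤ 2 * k - 1 := by
    have : (1 : ℝ) ≤ k := by exact_mod_cast hk
    linarith
  have h1 : |sliceY i v| ^ (-(1 + (0 : ℕ) : ℝ)) = |sliceY i v|⁻¹ := by
    rw [Nat.cast_zero, add_zero, Real.rpow_neg_one]
  rw [abs_mul, abs_inv, abs_abs, sliceMajorant, mul_left_comm, h1]
  refine mul_le_mul_of_nonneg_left ?_ (inv_nonneg.2 (abs_nonneg _))
  exact (abs_le_weightedNorm hw _).trans (mul_le_mul_of_nonneg_left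
    (bracket_sliceIns_rpow_le i _ v ha) ENNReal.toReal_nonneg)

lemma integrableOn_sliceGraph (hk : 2 ≤ k) {n₁ : ℕ} {w : Space k → ℝ} (hc : Continuous w)
    (hw : weightedNorm n₁ (2 * (k : ℝ) - 1) w ≠ ⊤) (i : Fin k) (m : ℝ) :
    IntegrableOn (fun v => |sliceY i v|⁻¹ * w (sliceGraph i m v)) (sliceSector i) :=
  ((integrableOn_sliceMajorant hk i 0 (by omega)).const_mul
    (weightedNorm n₁ (2 * (k : ℝ) - 1) w).toReal).mono'
    ((continuous_sliceY i).measurable.abs.inv.mul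
      (hc.measurable.comp (measurable_sliceGraph i m))).aestronglyMeasurable
    (Eventually.of_forall fun v => abs_inv_mul_sliceGraph_le (by omega) hw i m v)

lemma toReal_ofReal_inv_smul (w : Space k → ℝ) (i : Fin k) (m : ℝ) :
    (fun v => (ENNReal.ofReal |sliceY i v|⁻¹).toReal • w (sliceGraph i m v))
      = fun v => |sliceY i v|⁻¹ * w (sliceGraph i m v) := by
  ext v
  rw [ENNReal.toReal_ofReal (inv_nonneg.2 (abs_nonneg _)), smul_eq_mul]

lemma measurable_ofReal_inv_sliceY (i : Fin k) :
    Measurable (fun v => ENNReal.ofReal |sliceY i v|⁻¹) :=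
  (continuous_sliceY i).measurable.abs.inv.ennreal_ofReal

lemma integrable_map_sliceGraph (hk : 2 ≤ k) {n₁ : ℕ} {w : Space k → ℝ} (hc : Continuous w)
    (hw : weightedNorm n₁ (2 * (k : ℝ) - 1) w ≠ ⊤) (i : Fin k) (m : ℝ) :
    Integrable w ((sliceMeasure i).map (sliceGraph i m)) := by
  rw [integrable_map_measure hc.aestronglyMeasurable (measurable_sliceGraph i m).aemeasurable,
    sliceMeasure, integrable_withDensity_iff_integrable_smul' (measurable_ofReal_inv_sliceY i)
      (Eventually.of_forall fun _ => ENNReal.ofReal_lt_top)]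
  simp only [Function.comp_def]
  rw [toReal_ofReal_inv_smul]
  exact integrableOn_sliceGraph hk hc hw i m

lemma integrable_quadricMeasure (hk : 2 ≤ k) {n₁ : ℕ} {w : Space k → ℝ} (hc : Continuous w)
    (hw : weightedNorm n₁ (2 * (k : ℝ) - 1) w ≠ ⊤) (m : ℝ) : Integrable w (quadricMeasure k m) := by
  rw [quadricMeasure_eq_sum hk, integrable_finsetSum_measure]
  exact fun i _ => integrable_map_sliceGraph hk hc hw i m

lemma sigmaInf_eq_sum (hk : 2 ≤ k) {n₁ : ℕ} {w : Space k → ℝ} (hc : Continuous w)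
    (hw : weightedNorm n₁ (2 * (k : ℝ) - 1) w ≠ ⊤) (m : ℝ) :
    sigmaInf w m = ∑ i, ∫ v in sliceSector i, |sliceY i v|⁻¹ * w (sliceGraph i m v) := by
  rw [sigmaInf, quadricMeasure_eq_sum hk,
    integral_finsetSum_measure fun i _ => integrable_map_sliceGraph hk hc hw i m]
  refine Finset.sum_congr rfl fun i _ => ?_
  rw [integral_map (measurable_sliceGraph i m).aemeasurable hc.aestronglyMeasurable, sliceMeasure,
    integral_withDensity_eq_integral_toReal_smul (measurable_ofReal_inv_sliceY i)
      (Eventually.of_forall fun _ => ENNReal.ofReal_lt_top), toReal_ofReal_inv_smul]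

lemma exists_abs_deltaKernel_le : ∃ C : ℝ, 0 ≤ C ∧ ∀ u, |deltaKernel u| ≤ C := by
  simpa using exists_pow_mul_deltaKernel_le 0

lemma integrable_mul_deltaKernel {w : Space k → ℝ} (hw : Integrable w) (m x : ℝ) :
    Integrable (fun z => w z * (x⁻¹ * deltaKernel ((F0 z - m) / x))) := by
  obtain ⟨C, -, hC⟩ := exists_abs_deltaKernel_le
  refine hw.mul_bdd (c := |x⁻¹| * C) ?_ (Eventually.of_forall fun z => ?_)
  · exact (continuous_const.mul (continuous_deltaKernel.comp
      ((continuous_F0.sub continuous_const).div_const x))).aestronglyMeasurable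
  · rw [Real.norm_eq_abs, abs_mul]
    exact mul_le_mul_of_nonneg_left (hC _) (abs_nonneg _)

/-- Along the line the kernel has scale x/|y_i|, so using n + 1 = k - 2 derivatives adds
|y_i|^{-(n+1)} to the factor |y_i|⁻¹ of the substitution. -/
lemma exists_line_sub_le (n : ℕ) (hn : n + 3 = k) :
    ∃ C : ℝ, 0 ≤ C ∧ ∀ w : Space k → ℝ, ContDiff ℝ (n + 1 : ℕ) w →
      weightedNorm (n + 1) (2 * (k : ℝ) - 1) w ≠ ⊤ → ∀ i m x, 0 < x → ∀ v ∈ sliceSector i,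
      |(∫ ξ, w (sliceIns i ξ v) * (x⁻¹ * deltaKernel ((F0 (sliceIns i ξ v) - m) / x)))
          - |sliceY i v|⁻¹ * w (sliceGraph i m v)|
        ≤ C * x ^ (n + 1) * (weightedNorm (n + 1) (2 * (k : ℝ) - 1) w).toReal
          * sliceMajorant i (n + 1) v := by
  obtain ⟨C, hC0, hC⟩ := exists_integral_deltaKernel_sub_le n
  refine ⟨C, hC0, fun w hw hN i m x hx v hv => ?_⟩
  have hy : sliceY i v ≠ 0 := sliceSector_subset i hv
  have hy' : 0 < |sliceY i v| := abs_pos.2 hy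
  set N : ℝ := (weightedNorm (n + 1) (2 * (k : ℝ) - 1) w).toReal
  have ha : (0 : ℝ) ≤ 2 * k - 1 := by
    have : (1 : ℝ) ≤ k := by exact_mod_cast (by omega : 1 ≤ k)
    linarith
  have hM (s : ℝ) : |iteratedDeriv (n + 1) (fun τ => w (sliceIns i τ v)) s|
      ≤ N * bracket (sliceIncl i v) ^ (-(2 * (k : ℝ) - 1)) := by
    rw [iteratedDeriv_sliceIns hw]
    exact (abs_partialDeriv_le hN le_rfl _ _).trans (mul_le_mul_of_nonneg_left
      (bracket_sliceIns_rpow_le i _ v ha) ENNReal.toReal_nonneg)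
  simp only [F0_sliceIns]
  rw [integral_line (fun ξ => w (sliceIns i ξ v)) deltaKernel hx hy, sliceGraph, sliceG, ← mul_sub,
    abs_mul, abs_inv, abs_abs]
  refine (mul_le_mul_of_nonneg_left (hC _ (contDiff_sliceIns hw i v) _ hM _ _)
    (inv_nonneg.2 hy'.le)).trans (le_of_eq ?_)
  have h1 : |sliceY i v| ^ (-(1 + (n + 1 : ℕ) : ℝ)) = |sliceY i v|⁻¹ * (|sliceY i v| ^ (n + 1))⁻¹ := by
    rw [Real.rpow_neg hy'.le, Real.rpow_add hy', Real.rpow_one, Real.rpow_natCast, mul_inv]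
  rw [sliceMajorant, h1, abs_div, abs_of_pos hx, div_pow]
  ring

/-- The smoothed singular integral approximates the singular integral. -/
lemma exists_kernel_integral_sub_sigmaInf_le (n : ℕ) (hn : n + 3 = k) :
    ∃ C : ℝ, 0 ≤ C ∧ ∀ w : Space k → ℝ, ContDiff ℝ (n + 1 : ℕ) w → Integrable w →
      weightedNorm (n + 1) (2 * (k : ℝ) - 1) w ≠ ⊤ → ∀ m x, 0 < x →
      |(∫ z, w z * (x⁻¹ * deltaKernel ((F0 z - m) / x))) - sigmaInf w m|
        ≤ C * x ^ (n + 1) * (weightedNorm (n + 1) (2 * (k : ℝ) - 1) w).toReal := by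
  obtain ⟨C, hC0, hC⟩ := exists_line_sub_le n hn
  refine ⟨C * ∑ i : Fin k, ∫ v in sliceSector i, sliceMajorant i (n + 1) v, mul_nonneg hC0
    (Finset.sum_nonneg fun i _ => integral_nonneg fun v => sliceMajorant_nonneg i _ v),
    fun w hw hint hN m x hx => ?_⟩
  have hf := integrable_mul_deltaKernel hint m x
  rw [integral_eq_sum_sector (by omega) hf, sigmaInf_eq_sum (by omega) hw.continuous hN,
    ← Finset.sum_sub_distrib]
  refine (Finset.abs_sum_le_sum_abs _ _).trans ?_
  rw [Finset.mul_sum, Finset.sum_mul, Finset.sum_mul]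
  refine Finset.sum_le_sum fun i _ => ?_
  have hmaj := integrableOn_sliceMajorant (k := k) (by omega) i (n + 1) (by omega)
  rw [← integral_sub (integrable_slice hf i).integral_prod_left
    (integrableOn_sliceGraph (by omega) hw.continuous hN i m)]
  set N : ℝ := (weightedNorm (n + 1) (2 * (k : ℝ) - 1) w).toReal
  calc _ ≤ ∫ v in sliceSector i, C * x ^ (n + 1) * N * sliceMajorant i (n + 1) v := by
        rw [← Real.norm_eq_abs]
        refine norm_integral_le_of_norm_le (hmaj.const_mul _) ?_
        filter_upwards [ae_restrict_mem (measurableSet_sliceSector i)] with v hv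
        exact hC w hw hN i m x hx v hv
    _ = _ := by
        rw [integral_const_mul]
        ring

lemma exists_abs_sigmaInf_le (hk : 2 ≤ k) (n₁ : ℕ) :
    ∃ C : ℝ, 0 ≤ C ∧ ∀ w : Space k → ℝ, Continuous w → weightedNorm n₁ (2 * (k : ℝ) - 1) w ≠ ⊤ →
      ∀ m, |sigmaInf w m| ≤ C * (weightedNorm n₁ (2 * (k : ℝ) - 1) w).toReal := by
  refine ⟨∑ i : Fin k, ∫ v in sliceSector i, sliceMajorant i 0 v,
    Finset.sum_nonneg fun i _ => integral_nonneg fun v => sliceMajorant_nonneg i _ v,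
    fun w hc hN m => ?_⟩
  rw [sigmaInf_eq_sum hk hc hN, Finset.sum_mul]
  refine (Finset.abs_sum_le_sum_abs _ _).trans (Finset.sum_le_sum fun i _ => ?_)
  rw [mul_comm, ← integral_const_mul, ← Real.norm_eq_abs]
  exact norm_integral_le_of_norm_le
    ((integrableOn_sliceMajorant hk i 0 (by omega)).const_mul _)
    (Eventually.of_forall fun v => abs_inv_mul_sliceGraph_le (by omega) hN i m v)

lemma integral_mul_hFun {w : Space k → ℝ} (hw : Integrable w) (m : ℝ) {x : ℝ} (hx : 0 < x) :
    ∫ z, w z * hFun x (F0 z - m) = (∫ z, w z * (x⁻¹ * deltaKernel ((F0 z - m) / x)))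
      + x⁻¹ * (omegaSum x - omegaLogMass) * ∫ z, w z := by
  simp only [hFun_eq hx, mul_add]
  rw [integral_add (integrable_mul_deltaKernel hw m x) (hw.mul_const _), integral_mul_const]
  ring

lemma integrable_mul_hFun {w : Space k → ℝ} (hw : Integrable w) (m : ℝ) {x : ℝ} (hx : 0 < x) :
    Integrable (fun z => w z * hFun x (F0 z - m)) := by
  simp only [hFun_eq hx, mul_add]
  exact (integrable_mul_deltaKernel hw m x).add (hw.mul_const _)

lemma exists_hFun_integral_sub_sigmaInf_le_pow (n : ℕ) (hn : n + 3 = k) :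
    ∃ C : ℝ, 0 ≤ C ∧ ∀ w : Space k → ℝ, ContDiff ℝ (n + 1 : ℕ) w →
      weightedNorm (n + 1) (2 * (k : ℝ) - 1) w ≠ ⊤ → weightedNorm 0 (2 * (k : ℝ) + 1) w ≠ ⊤ →
      ∀ m x, 0 < x → |(∫ z, w z * hFun x (F0 z - m)) - sigmaInf w m|
        ≤ C * x ^ (n + 1) * ((weightedNorm (n + 1) (2 * (k : ℝ) - 1) w).toReal
          + (weightedNorm 0 (2 * (k : ℝ) + 1) w).toReal) := by
  obtain ⟨C₁, hC₁, h1⟩ := exists_kernel_integral_sub_sigmaInf_le n hn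
  -- One power more than needed, as the part of h independent of t carries a factor x⁻¹. It is
  -- paired with ∫ w, which the norm of weight d + 1 controls.
  obtain ⟨C₂, hC₂, h2⟩ := exists_omegaSum_sub_le (n + 2)
  set B : ℝ := ∫ z : Space k, bracket z ^ (-(2 * (k : ℝ) + 1))
  have hB : 0 ≤ B := integral_nonneg fun z => Real.rpow_nonneg (bracket_pos z).le _
  refine ⟨C₁ + C₂ * B, by positivity, fun w hw hN₁ hN₂ m x hx => ?_⟩
  have hint := integrable_of_weightedNorm (by linarith) hw.continuous hN₂
  set N₁ : ℝ := (weightedNorm (n + 1) (2 * (k : ℝ) - 1) w).toReal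
  set N₂ : ℝ := (weightedNorm 0 (2 * (k : ℝ) + 1) w).toReal
  have hN₁' : 0 ≤ N₁ := ENNReal.toReal_nonneg
  have hN₂' : 0 ≤ N₂ := ENNReal.toReal_nonneg
  have hw' : |∫ z, w z| ≤ N₂ * B := (abs_integral_le_integral_abs).trans
    (integral_abs_le_of_weightedNorm (by linarith) hw.continuous hN₂)
  have h3 : |x⁻¹ * (omegaSum x - omegaLogMass) * ∫ z, w z| ≤ C₂ * x ^ (n + 1) * (N₂ * B) := by
    rw [abs_mul, abs_mul, abs_inv, abs_of_pos hx]
    refine mul_le_mul ?_ hw' (abs_nonneg _) (by positivity)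
    rw [inv_mul_le_iff₀ hx]
    refine (h2 x hx).trans (le_of_eq ?_)
    ring
  rw [integral_mul_hFun hint m hx, add_sub_right_comm]
  refine (abs_add_le _ _).trans ((add_le_add (h1 w hw hint hN₁ m x hx) h3).trans ?_)
  have h4 : 0 ≤ C₁ * x ^ (n + 1) * N₂ := by positivity
  have h5 : 0 ≤ C₂ * B * x ^ (n + 1) * N₁ := by positivity
  linarith

/-- For x ≥ 1 no cancellation is needed: h(x, ·) is bounded, and the two terms are estimated
separately. -/
lemma exists_hFun_integral_sub_sigmaInf_le_one (n : ℕ) (hk : 2 ≤ k) :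
    ∃ C : ℝ, 0 ≤ C ∧ ∀ w : Space k → ℝ, Continuous w →
      weightedNorm (n + 1) (2 * (k : ℝ) - 1) w ≠ ⊤ → weightedNorm 0 (2 * (k : ℝ) + 1) w ≠ ⊤ →
      ∀ m x, 1 ≤ x → |(∫ z, w z * hFun x (F0 z - m)) - sigmaInf w m|
        ≤ C * ((weightedNorm (n + 1) (2 * (k : ℝ) - 1) w).toReal
          + (weightedNorm 0 (2 * (k : ℝ) + 1) w).toReal) := by
  obtain ⟨C₁, hC₁, h1⟩ := exists_abs_sigmaInf_le hk (n + 1)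
  obtain ⟨C₂, hC₂, h2⟩ := exists_omegaSum_sub_le 1
  obtain ⟨C₃, hC₃, h3⟩ := exists_abs_deltaKernel_le
  set B : ℝ := ∫ z : Space k, bracket z ^ (-(2 * (k : ℝ) + 1))
  have hB : 0 ≤ B := integral_nonneg fun z => Real.rpow_nonneg (bracket_pos z).le _
  refine ⟨C₁ + (C₃ + C₂) * B, by positivity, fun w hw hN₁ hN₂ m x hx1 => ?_⟩
  have hx : 0 < x := by linarith
  have hint := integrable_of_weightedNorm (by linarith) hw hN₂
  set N₁ : ℝ := (weightedNorm (n + 1) (2 * (k : ℝ) - 1) w).toReal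
  set N₂ : ℝ := (weightedNorm 0 (2 * (k : ℝ) + 1) w).toReal
  have hN₁' : 0 ≤ N₁ := ENNReal.toReal_nonneg
  have hN₂' : 0 ≤ N₂ := ENNReal.toReal_nonneg
  have hbound (z : Space k) : ‖w z * hFun x (F0 z - m)‖ ≤ (C₃ + C₂) * |w z| := by
    rw [Real.norm_eq_abs, abs_mul, mul_comm]
    refine mul_le_mul_of_nonneg_right ?_ (abs_nonneg _)
    rw [hFun_eq hx, ← mul_add, abs_mul, abs_inv, abs_of_pos hx, inv_mul_le_iff₀ hx]
    have h4 : C₃ ≤ x * C₃ := le_mul_of_one_le_left hC₃ hx1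
    have h5 := h2 x hx
    rw [pow_one] at h5
    refine (abs_add_le _ _).trans ((add_le_add (h3 _) h5).trans ?_)
    linarith
  have h6 : |∫ z, w z * hFun x (F0 z - m)| ≤ (C₃ + C₂) * (N₂ * B) := by
    refine (norm_integral_le_of_norm_le (hint.abs.const_mul (C₃ + C₂))
      (Eventually.of_forall hbound)).trans ?_
    rw [integral_const_mul]
    exact mul_le_mul_of_nonneg_left
      (integral_abs_le_of_weightedNorm (by linarith) hw hN₂) (by positivity)
  refine (abs_sub _ _).trans ((add_le_add h6 (h1 w hw hN₁ m)).trans ?_)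
  have h7 : 0 ≤ C₁ * N₂ := by positivity
  have h8 : 0 ≤ (C₃ + C₂) * B * N₁ := by positivity
  linarith

/-- The weighted integral of the delta function approximates the singular integral. -/
lemma exists_hFun_integral_sub_sigmaInf_le (n : ℕ) (hn : n + 3 = k) :
    ∃ C : ℝ, 0 ≤ C ∧ ∀ w : Space k → ℝ, ContDiff ℝ (n + 1 : ℕ) w →
      weightedNorm (n + 1) (2 * (k : ℝ) - 1) w ≠ ⊤ → weightedNorm 0 (2 * (k : ℝ) + 1) w ≠ ⊤ →
      ∀ m x s : ℝ, 0 < x → 0 ≤ s → s ≤ n + 1 → |(∫ z, w z * hFun x (F0 z - m)) - sigmaInf w m|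
        ≤ C * x ^ s * ((weightedNorm (n + 1) (2 * (k : ℝ) - 1) w).toReal
          + (weightedNorm 0 (2 * (k : ℝ) + 1) w).toReal) := by
  obtain ⟨C₁, hC₁, h1⟩ := exists_hFun_integral_sub_sigmaInf_le_pow n hn
  obtain ⟨C₂, hC₂, h2⟩ := exists_hFun_integral_sub_sigmaInf_le_one (k := k) n (by omega)
  refine ⟨C₁ + C₂, by positivity, fun w hw hN₁ hN₂ m x s hx hs0 hs1 => ?_⟩
  have hxs : 0 ≤ x ^ s := Real.rpow_nonneg hx.le s
  -- For x ≤ 1 the exponent n + 1 may be lowered to s; for x ≥ 1 one has x^s ≥ 1. This freedom in s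
  -- is what allows the sum over all q.
  rcases le_total x 1 with h | h
  · refine (h1 w hw hN₁ hN₂ m x hx).trans (mul_le_mul_of_nonneg_right ?_ (by positivity))
    have h3 : x ^ (n + 1) ≤ x ^ s := by
      rw [← Real.rpow_natCast]
      exact Real.rpow_le_rpow_of_exponent_ge hx h (by exact_mod_cast hs1)
    calc C₁ * x ^ (n + 1) ≤ C₁ * x ^ s := mul_le_mul_of_nonneg_left h3 hC₁
      _ ≤ (C₁ + C₂) * x ^ s := mul_le_mul_of_nonneg_right (by linarith) hxs
  · refine (h2 w hw.continuous hN₁ hN₂ m x h).trans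
      (mul_le_mul_of_nonneg_right ?_ (by positivity))
    have h3 : 1 ≤ x ^ s := Real.one_le_rpow h hs0
    nlinarith

/-! ### Rescaling by L and summation over q. -/

lemma oscIntegrand_zero (w : Space k → ℝ) (m : ℝ) {L : ℝ} (hL : L ≠ 0) (q : ℕ) (z : Space k) :
    oscIntegrand w m L q 0 z
      = ((w (L⁻¹ • z) * hFun (q / L) (F0 (L⁻¹ • z) - m) : ℝ) : ℂ) := by
  have h1 : Ft (m * L ^ 2) z / L ^ 2 = F0 (L⁻¹ • z) - m := by
    have : F0 (L⁻¹ • z) = (L ^ 2)⁻¹ * F0 z := by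
      simp only [F0, PiLp.smul_apply, smul_eq_mul, Finset.mul_sum]
      refine Finset.sum_congr rfl fun i _ => ?_
      ring
    rw [this, Ft]
    field_simp
  have h2 : dot z (intVec (0 : Fin k ⊕ Fin k → ℤ)) = 0 := by simp [dot, intVec]
  rw [oscIntegrand, h1, h2]
  simp [expQ]

lemma integrable_oscIntegrand {w : Space k → ℝ} (hw : Integrable w) (m : ℝ) {L : ℝ} (hL : 0 < L)
    {q : ℕ} (hq : 0 < q) : Integrable (oscIntegrand w m L q 0) := by
  have h := (integrable_mul_hFun hw m (x := q / L) (by positivity)).comp_smul (inv_ne_zero hL.ne')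
  have h1 := h.ofReal (𝕜 := ℂ)
  refine h1.congr (Eventually.of_forall fun z => ?_)
  rw [oscIntegrand_zero w m hL.ne']
  rfl

lemma oscIntegral_zero (w : Space k → ℝ) (m : ℝ) {L : ℝ} (hL : 0 < L) (q : ℕ) :
    oscIntegral w m L q 0 = (L : ℂ) ^ (2 * k) * ((∫ z, w z * hFun (q / L) (F0 z - m) : ℝ) : ℂ) := by
  simp only [oscIntegral, oscIntegrand_zero w m hL.ne']
  rw [integral_complex_ofReal, Measure.integral_comp_inv_smul_of_nonneg volume
    (fun z => w z * hFun (q / L) (F0 z - m)) hL.le, finrank_euclideanSpace]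
  simp only [Fintype.card_sum, Fintype.card_fin]
  rw [smul_eq_mul, two_mul]
  push_cast
  rfl

lemma tsum_pnat_singularTerm (N : ℤ) :
    ∑' q : ℕ+, singularTerm k N q = ∑' q : ℕ, singularTerm k N q := by
  refine PNat.coe_injective.tsum_eq fun q hq => ?_
  have h0 : q ≠ 0 := by
    rintro rfl
    refine hq (norm_le_zero_iff.1 ((norm_singularTerm_le k N 0).trans ?_))
    simp
  exact ⟨⟨q, Nat.pos_of_ne_zero h0⟩, rfl⟩

lemma nTerm_zero_eq {w : Space k → ℝ} {m L : ℝ} (hL : 0 < L) {N : ℤ} (hN : m * L ^ 2 = N) (q : ℕ+) :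
    nTerm w m L 0 q = singularTerm k N q
      * ((L : ℂ) ^ (2 * k) * ((∫ z, w z * hFun ((q : ℕ) / L) (F0 z - m) : ℝ) : ℂ)) := by
  rw [nTerm, hN, singularTerm_eq k N q.pos.ne', oscIntegral_zero w m hL]

/-- Bookkeeping of q^{1-k} L^{2k} (q/L)^{k-2-ε}; giving up ε in the exponent is exactly what makes
the sum over q converge. -/
lemma norm_singularTerm_mul_le {L ε E A B : ℝ} (hL : 0 < L) (N : ℤ) (q : ℕ+)
    (hE : |E - A| ≤ B * (((q : ℕ) : ℝ) / L) ^ ((k : ℝ) - 2 - ε)) :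
    ‖singularTerm k N q * ((L : ℂ) ^ (2 * k) * (E : ℂ))
        - (L : ℂ) ^ (2 * k) * (A : ℂ) * singularTerm k N q‖
      ≤ B * L ^ ((k : ℝ) + 2 + ε) * ((q : ℕ) : ℝ) ^ (-(1 + ε)) := by
  have hq : (0 : ℝ) < ((q : ℕ) : ℝ) := by exact_mod_cast q.pos
  have h1 : singularTerm k N q * ((L : ℂ) ^ (2 * k) * (E : ℂ))
        - (L : ℂ) ^ (2 * k) * (A : ℂ) * singularTerm k N q
      = singularTerm k N q * ((L : ℂ) ^ (2 * k) * ((E - A : ℝ) : ℂ)) := by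
    push_cast
    ring
  rw [h1, norm_mul, norm_mul, norm_pow, Complex.norm_real, Complex.norm_real, Real.norm_eq_abs,
    Real.norm_eq_abs, abs_of_pos hL]
  calc _ ≤ ((((q : ℕ) : ℝ) ^ k)⁻¹ * ((q : ℕ) : ℝ))
        * (L ^ (2 * k) * (B * (((q : ℕ) : ℝ) / L) ^ ((k : ℝ) - 2 - ε))) := by
        gcongr
        exact norm_singularTerm_le k N q
    _ = _ := by
        have e1 : L ^ ((k : ℝ) + 2 + ε) = L ^ (2 * k) * (L ^ ((k : ℝ) - 2 - ε))⁻¹ := by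
          rw [← Real.rpow_natCast, ← Real.rpow_neg hL.le, ← Real.rpow_add hL]
          congr 1
          push_cast
          ring
        have e2 : ((q : ℕ) : ℝ) ^ (-(1 + ε)) = (((q : ℕ) : ℝ) ^ k)⁻¹ * ((q : ℕ) : ℝ)
            * ((q : ℕ) : ℝ) ^ ((k : ℝ) - 2 - ε) := by
          rw [← Real.rpow_natCast, ← Real.rpow_neg hq.le, ← Real.rpow_add_one hq.ne',
            ← Real.rpow_add hq]
          congr 1
          ring
        rw [e1, e2, Real.div_rpow hq.le hL.le]
        ring

end

end QuadCircle

end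

/-- Here `d = 2 * k` is even and larger than `4`. The constant `C` depends only on `d`, `γ₂` and a
compact interval `[m₁, m₂]` that contains `m`. The first five conclusions say that the integrals,
the series and the product that enter the estimate converge. -/
theorem mainTheorem2 (k : ℕ) (hk : 3 ≤ k) (γ₂ : ℝ) (hγ₀ : 0 < γ₂) (hγ₁ : γ₂ < 1) (m₁ m₂ : ℝ) :
    ∃ C : ℝ, 0 < C ∧ ∀ m : ℝ, m₁ ≤ m → m ≤ m₂ → ∀ L : ℝ, 1 < L → (∃ N : ℤ, m * L ^ 2 = N) →
      ∀ w : Space k → ℝ, ContDiff ℝ ((k - 2 : ℕ) : WithTop ℕ∞) w →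
        weightedNorm (k - 2) (2 * (k : ℝ) - 1) w ≠ ⊤ →
        weightedNorm 0 (2 * (k : ℝ) + 1) w ≠ ⊤ →
        MeasureTheory.Integrable w (quadricMeasure k m) ∧
        (∀ q : ℕ+, MeasureTheory.Integrable (oscIntegrand w m L q 0)) ∧
        Summable (nTerm w m L 0) ∧
        (∀ p : Nat.Primes, Summable (sigmaPTerm k (m * L ^ 2) p)) ∧
        Multipliable (fun p : Nat.Primes => sigmaP k (m * L ^ 2) p) ∧
        ‖J0 w m L - (L : ℂ) ^ (2 * k) * (sigmaInf w m : ℂ)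
            * ∏' p : Nat.Primes, sigmaP k (m * L ^ 2) p‖
          ≤ C * L ^ ((k : ℝ) + 2 + γ₂ * ((k : ℝ) - 1))
            * ((weightedNorm (k - 2) (2 * (k : ℝ) - 1) w).toReal
              + (weightedNorm 0 (2 * (k : ℝ) + 1) w).toReal) := by
  obtain ⟨n, rfl⟩ : ∃ n, k = n + 3 := ⟨k - 3, by omega⟩
  obtain ⟨C, hC0, hC⟩ := exists_hFun_integral_sub_sigmaInf_le n rfl
  -- The first bound keeps the power of L within the claim, the second keeps the exponent s = k - 2
  -- - ε nonnegative (n + 1 = k - 2).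
  set ε : ℝ := min (γ₂ * (((n + 3 : ℕ) : ℝ) - 1)) (n + 1) with hε
  have hn0 : (0 : ℝ) ≤ n := n.cast_nonneg
  have hkn : ((n + 3 : ℕ) : ℝ) = n + 3 := by push_cast; ring
  have hε0 : 0 < ε := lt_min (mul_pos hγ₀ (by linarith)) (by linarith)
  have hε2 : ε ≤ γ₂ * (((n + 3 : ℕ) : ℝ) - 1) := min_le_left _ _
  have hε1 : ε ≤ n + 1 := min_le_right _ _
  have hsum : Summable (fun q : ℕ+ => ((q : ℕ) : ℝ) ^ (-(1 + ε))) :=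
    (Real.summable_nat_rpow.2 (by linarith)).comp_injective PNat.coe_injective
  set Z : ℝ := ∑' q : ℕ+, ((q : ℕ) : ℝ) ^ (-(1 + ε))
  have hZ : 0 ≤ Z := tsum_nonneg fun q => Real.rpow_nonneg (Nat.cast_nonneg _) _
  -- The summand 1 only makes the constant strictly positive.
  refine ⟨C * Z + 1, by positivity, fun m _ _ L hL ⟨N, hN⟩ w hw hN₁ hN₂ => ?_⟩
  have hL0 : 0 < L := by linarith
  have hsub : n + 3 - 2 = n + 1 := by omega
  rw [hsub] at hw hN₁ ⊢
  have hint : Integrable w := integrable_of_weightedNorm (by linarith) hw.continuous hN₂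
  have hprod := hasProd_sigmaP hk N
  set N₁ : ℝ := (weightedNorm (n + 1) (2 * ((n + 3 : ℕ) : ℝ) - 1) w).toReal
  set N₂ : ℝ := (weightedNorm 0 (2 * ((n + 3 : ℕ) : ℝ) + 1) w).toReal
  have hN₁0 : 0 ≤ N₁ := ENNReal.toReal_nonneg
  have hN₂0 : 0 ≤ N₂ := ENNReal.toReal_nonneg
  -- The deviation of each term from its main term; its summability, with that of the singular
  -- series, also yields the convergence of J₀.
  set D : ℕ+ → ℂ := fun q => nTerm w m L 0 q
    - (L : ℂ) ^ (2 * (n + 3)) * (sigmaInf w m : ℂ) * singularTerm (n + 3) N q with hD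
  have hle (q : ℕ+) : ‖D q‖ ≤ C * (N₁ + N₂) * L ^ (((n + 3 : ℕ) : ℝ) + 2 + ε)
      * ((q : ℕ) : ℝ) ^ (-(1 + ε)) := by
    rw [hD]
    simp only
    rw [nTerm_zero_eq hL0 hN]
    refine norm_singularTerm_mul_le hL0 N q ?_
    have hq : (0 : ℝ) < ((q : ℕ) : ℝ) / L := div_pos (by exact_mod_cast q.pos) hL0
    refine (hC w hw hN₁ hN₂ m _ (((n + 3 : ℕ) : ℝ) - 2 - ε) hq (by linarith)
      (by linarith)).trans (le_of_eq ?_)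
    ring
  have hDs : Summable D := Summable.of_norm_bounded (hsum.mul_left _) hle
  have hs : Summable (fun q : ℕ+ => singularTerm (n + 3) N q) :=
    (summable_norm_singularTerm hk N).of_norm.comp_injective PNat.coe_injective
  have hnT : Summable (nTerm w m L 0) := by
    refine (hDs.add (hs.mul_left ((L : ℂ) ^ (2 * (n + 3)) * (sigmaInf w m : ℂ)))).congr fun q => ?_
    simp [hD]
  refine ⟨integrable_quadricMeasure (by omega) hw.continuous hN₁ m,
    fun q => integrable_oscIntegrand hint m hL0 q.pos, hnT, fun p => ?_, ?_, ?_⟩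
  · rw [hN]
    exact summable_sigmaPTerm hk N p
  · rw [hN]
    exact hprod.multipliable
  · rw [hN, hprod.tprod_eq, ← tsum_pnat_singularTerm, J0, nFreq, ← tsum_mul_left,
      ← hnT.tsum_sub (hs.mul_left _)]
    refine (tsum_of_norm_bounded (hsum.mul_left _).hasSum hle).trans ?_
    rw [tsum_mul_left]
    have h1 : L ^ (((n + 3 : ℕ) : ℝ) + 2 + ε)
        ≤ L ^ (((n + 3 : ℕ) : ℝ) + 2 + γ₂ * (((n + 3 : ℕ) : ℝ) - 1)) :=
      Real.rpow_le_rpow_of_exponent_le hL.le (by linarith)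
    calc C * (N₁ + N₂) * L ^ (((n + 3 : ℕ) : ℝ) + 2 + ε) * Z
        = C * Z * L ^ (((n + 3 : ℕ) : ℝ) + 2 + ε) * (N₁ + N₂) := by ring
      _ ≤ _ := by
        gcongr
        linarith
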